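/- Let $n\ge 1$. Write points of $\mathbb R^{n+1}=\mathbb R^n\times\mathbb R$ as $(X,t)$, let $d_p((X,t),(Y,s))=|X-Y|+|t-s|^{1/2}$ be the parabolic distance (diameters of sets are taken with respect to $d_p$), and let $Q_r(X,t)=\{(Y,s): |y_i-x_i|<r\ (1\le i\le n),\ |s-t|<r^2\}$ be the parabolic cube of length $r>0$. The parabolic Hausdorff measure $\mathcal H^{n+1}_{\rm p}$ is defined by $$\mathcal H^{n+1}_{\rm p}(A)=\lim_{\delta\to0^+}\inf\Big\{\sum_k \operatorname{diam}(A_k)^{n+1}: A\subset\bigcup_k A_k,\ A_k \text{ parabolic cubes},\ \operatorname{diam}(A_k)\le\delta\Big\},$$ the infimum being over countable coverings. For a closed set $\Sigma\subset\mathbb R^{n+1}$ put $\sigma=\mathcal H^{n+1}_{\rm p}\lfloor_\Sigma$, $\Delta(X,t,r)=\Sigma\cap Q_r(X,t)$, $T_0=\inf\{t:(X,t)\in\Sigma\}$ and $T_1=\sup\{t:(X,t)\in\Sigma\}$ (possibly infinite). * $\Sigma$ is *parabolic Ahlfors–David regular* (ADR) with constant $M\ge1$ if $M^{-1}r^{n+1}\le\sigma(\Delta(X,t,r))\le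 M r^{n+1}$ for all $(X,t)\in\Sigma$ with $T_0<t<T_1$ and all $0<r<\operatorname{diam}\Sigma$. * $\Sigma$ satisfies the *weak time-synchronized two cube condition* with constant $\gamma_1\in(0,1)$ if for all $(X,t)\in\Sigma$ with $T_0<t<T_1$ and all $0<r<\operatorname{diam}\Sigma$ there are two parabolic cubes $Q_\rho(X_1,t_1)$, $Q_\rho(X_2,t_2)$, both contained in $Q_r(X,t)$, with $\gamma_1 r\le\rho<r$ and $t_1=t_2$, such that $Q_\rho(X_1,t_1)\cap(\mathbb R^n\times(T_0,T_1))$ and $Q_\rho(X_2,t_2)\cap(\mathbb R^n\times(T_0,T_1))$ are contained in different connected components of $\mathbb R^{n+1}\setminus\Sigma$. * A function $\psi:\mathbb R^{n-1}\times\mathbb R\to\mathbb R$ is Lip(1,1/2) with constant $b\ge0$ if $|\psi(x,t)-\psi(y,s)|\le b(|x-y|+|t-s|^{1/2})$ for all $(x,t),(y,s)$; its graph is $\Sigma_\psi=\{(x,x_n,t)\in\mathbb R^{n-1}\times\mathbb R\times\mathbb R: x_n=\psi(x,t)\}$. Let $\pi(x,x_n,t)=(x,0,t)$ be the orthogonal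 projection onto $\{x_n=0\}\cong\mathbb R^n$, and let $\mathcal H^n$ be $n$-dimensional Hausdorff (that is, Lebesgue) measure on this plane. * $\Sigma$ contains *uniform big pieces of Lip(1,1/2) graphs* with constants $(\epsilon,b)$, $\epsilon>0$, if for all $(X,t)\in\Sigma$ with $T_0<t<T_1$ and all $0<R<\operatorname{diam}\Sigma$ there are a rotation of the space variable in $\mathbb R^n$ and a Lip(1,1/2) function $\psi$ with constant $b$ such that, in the rotated coordinates, $$\mathcal H^n\big(\pi(\Sigma_\psi\cap\Delta(X,t,R))\big)\ge\epsilon R^{n+1}.$$ **Theorem.** Let $n\ge1$, $M\ge1$ and $\gamma_1\in(0,1)$. There are $\epsilon>0$ and $b\ge0$, depending only on $n$, $M$ and $\gamma_1$, such that every closed set $\Sigma\subset\mathbb R^{n+1}$ which is parabolic ADR with constant $M$ and satisfies the weak time-synchronized two cube condition with constant $\gamma_1$ contains uniform big pieces of Lip(1,1/2) graphs with constants $(\epsilon,b)$. -/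

import Mathlib

open MeasureTheory Set
open scoped ENNReal

noncomputable section

/-- Space-time `ℝ^{n+1} = ℝⁿ × ℝ`; a point is written `(X, t)`. It carries the usual product
topology and its Borel sets, but its distance is the parabolic distance
`d_p((X,t),(Y,s)) = |X - Y| + |t - s|^{1/2}`. -/
def SpaceTime (n : ℕ) : Type := EuclideanSpace ℝ (Fin n) × ℝ

namespace SpaceTime

instance instTopologicalSpace (n : ℕ) : TopologicalSpace (SpaceTime n) :=
  inferInstanceAs (TopologicalSpace (EuclideanSpace ℝ (Fin n) × ℝ))

/-- The parabolic distance `|X - Y| + |t - s|^{1/2}`. -/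
def parDist {n : ℕ} (p q : SpaceTime n) : ℝ := ‖p.1 - q.1‖ + Real.sqrt |p.2 - q.2|

theorem sqrt_abs_triangle (a b c : ℝ) :
    Real.sqrt |a - c| ≤ Real.sqrt |a - b| + Real.sqrt |b - c| := by
  apply Real.sqrt_le_iff.mpr
  refine ⟨by positivity, ?_⟩
  have h1 := Real.sq_sqrt (abs_nonneg (a - b))
  have h2 := Real.sq_sqrt (abs_nonneg (b - c))
  have h3 := abs_sub_le a b c
  nlinarith [Real.sqrt_nonneg |a - b|, Real.sqrt_nonneg |b - c|,
    mul_nonneg (Real.sqrt_nonneg |a - b|) (Real.sqrt_nonneg |b - c|)]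

/-- The metric space structure given by `parDist`, before its topology is identified. -/
abbrev metricAux (n : ℕ) : MetricSpace (SpaceTime n) where
  dist := parDist
  dist_self p := by simp [parDist]
  dist_comm p q := by simp only [parDist, norm_sub_rev p.1, abs_sub_comm p.2]
  dist_triangle p q r := by
    have h1 := norm_sub_le_norm_sub_add_norm_sub p.1 q.1 r.1
    have h2 := sqrt_abs_triangle p.2 q.2 r.2
    simp only [parDist]
    linarith
  eq_of_dist_eq_zero := by
    intro p q h
    have h1 := norm_nonneg (p.1 - q.1)
    have h2 := Real.sqrt_nonneg |p.2 - q.2|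
    simp only [parDist] at h
    have h3 : ‖p.1 - q.1‖ = 0 := by linarith
    have h4 : Real.sqrt |p.2 - q.2| = 0 := by linarith
    rw [Real.sqrt_eq_zero (abs_nonneg _), abs_eq_zero, sub_eq_zero] at h4
    rw [norm_eq_zero, sub_eq_zero] at h3
    exact Prod.ext h3 h4

/-- The parabolic distance induces the usual topology of `ℝⁿ × ℝ`. -/
theorem topology_eq (n : ℕ) :
    instTopologicalSpace n = (metricAux n).toUniformSpace.toTopologicalSpace := by
  refine TopologicalSpace.ext_nhds fun p => ?_
  let m : MetricSpace (EuclideanSpace ℝ (Fin n) × ℝ) := inferInstance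
  refine Filter.HasBasis.ext (p := fun ε : ℝ => 0 < ε) (p' := fun ε : ℝ => 0 < ε)
    (s := fun ε => {q : SpaceTime n | m.dist q p < ε})
    (s' := fun ε => {q : SpaceTime n | parDist q p < ε})
    (@Metric.nhds_basis_ball _ m.toPseudoMetricSpace p)
    (@Metric.nhds_basis_ball _ (metricAux n).toPseudoMetricSpace p) ?_ ?_
  · intro ε hε
    refine ⟨min ε (Real.sqrt ε), lt_min hε (Real.sqrt_pos.mpr hε), fun q hq => ?_⟩
    have hq' : ‖q.1 - p.1‖ + Real.sqrt |q.2 - p.2| < min ε (Real.sqrt ε) := hq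
    have h1 := norm_nonneg (q.1 - p.1)
    have h2 := Real.sqrt_nonneg |q.2 - p.2|
    have h3 := lt_of_lt_of_le hq' (min_le_left _ _)
    have h4 := lt_of_lt_of_le hq' (min_le_right _ _)
    have h5 : |q.2 - p.2| < ε := (Real.sqrt_lt_sqrt_iff (abs_nonneg _)).mp (by linarith)
    change max (dist q.1 p.1) (dist q.2 p.2) < ε
    rw [dist_eq_norm, Real.dist_eq]
    exact max_lt (by linarith) h5
  · intro ε hε
    refine ⟨min (ε / 2) ((ε / 2) ^ 2), by positivity, fun q hq => ?_⟩
    have hq' : max (dist q.1 p.1) (dist q.2 p.2) < min (ε / 2) ((ε / 2) ^ 2) := hq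
    rw [dist_eq_norm, Real.dist_eq] at hq'
    obtain ⟨h1, h2⟩ := lt_min_iff.mp hq'
    have h3 := lt_of_le_of_lt (le_max_left _ _) h1
    have h4 := lt_of_le_of_lt (le_max_right _ _) h2
    have h5 : Real.sqrt |q.2 - p.2| < ε / 2 := (Real.sqrt_lt' (by positivity)).mpr h4
    change ‖q.1 - p.1‖ + Real.sqrt |q.2 - p.2| < ε
    linarith

instance instMetricSpace (n : ℕ) : MetricSpace (SpaceTime n) :=
  (metricAux n).replaceTopology (topology_eq n)

instance instMeasurableSpace (n : ℕ) : MeasurableSpace (SpaceTime n) := borel _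

instance instBorelSpace (n : ℕ) : BorelSpace (SpaceTime n) := ⟨rfl⟩

theorem dist_def {n : ℕ} (p q : SpaceTime n) :
    dist p q = ‖p.1 - q.1‖ + Real.sqrt |p.2 - q.2| := rfl

/-- The parabolic cube `Q_r(X,t) = {(Y,s) : |yᵢ - xᵢ| < r for all i, |t - s| < r²}`. -/
def cube {n : ℕ} (p : SpaceTime n) (r : ℝ) : Set (SpaceTime n) :=
  {q | (∀ i, |q.1 i - p.1 i| < r) ∧ |q.2 - p.2| < r ^ 2}

/-- The surface cube `Δ(X,t,r) = S ∩ Q_r(X,t)`. -/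
def surfaceCube {n : ℕ} (S : Set (SpaceTime n)) (p : SpaceTime n) (r : ℝ) :
    Set (SpaceTime n) := S ∩ cube p r

/-- `s` is a parabolic cube `Q_r(X,t)` with `r > 0`. -/
def IsCube {n : ℕ} (s : Set (SpaceTime n)) : Prop :=
  ∃ (p : SpaceTime n) (r : ℝ), 0 < r ∧ s = cube p r

open Classical in
/-- Parabolic Hausdorff measure of homogeneous dimension `η`: the limit, as `δ → 0`, of the
infima of `∑ₖ diam_p(Aₖ)^η` over countable coverings by parabolic cubes `Aₖ` of parabolic
diameter at most `δ` (sets that are not cubes are priced at `∞`). -/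
def parHausdorff (n : ℕ) (η : ℝ) : Measure (SpaceTime n) :=
  Measure.mkMetric' fun s => if IsCube s then Metric.ediam s ^ η else ⊤

/-- Surface measure on `S ⊆ ℝ^{n+1}`: the parabolic Hausdorff measure of homogeneous dimension
`n + 1`, restricted to `S`. -/
def surfaceMeasure {n : ℕ} (S : Set (SpaceTime n)) : Measure (SpaceTime n) :=
  (parHausdorff n ((n : ℝ) + 1)).restrict S

/-- `T₀ = inf {t : (X,t) ∈ S}`, possibly `-∞`. -/
def initialTime {n : ℕ} (S : Set (SpaceTime n)) : EReal := ⨅ p ∈ S, ((p.2 : ℝ) : EReal)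

/-- `T₁ = sup {t : (X,t) ∈ S}`, possibly `+∞`. -/
def finalTime {n : ℕ} (S : Set (SpaceTime n)) : EReal := ⨆ p ∈ S, ((p.2 : ℝ) : EReal)

/-- The open time strip `ℝⁿ × (T₀, T₁)` of `S`. -/
def timeStrip {n : ℕ} (S : Set (SpaceTime n)) : Set (SpaceTime n) :=
  {p | initialTime S < ((p.2 : ℝ) : EReal) ∧ ((p.2 : ℝ) : EReal) < finalTime S}

/-- `(X,t) ∈ S`, `T₀ < t < T₁` and `0 < r < diam S` (parabolic diameter, possibly infinite). -/
def Admissible {n : ℕ} (S : Set (SpaceTime n)) (p : SpaceTime n) (r : ℝ) : Prop :=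
  p ∈ S ∧ p ∈ timeStrip S ∧ 0 < r ∧ ENNReal.ofReal r < Metric.ediam S

/-- Parabolic Ahlfors–David regularity with constant `M`:
`M⁻¹ r^{n+1} ≤ σ(Δ(X,t,r)) ≤ M r^{n+1}`. -/
def IsParabolicADR {n : ℕ} (S : Set (SpaceTime n)) (M : ℝ) : Prop :=
  ∀ (p : SpaceTime n) (r : ℝ), Admissible S p r →
    ENNReal.ofReal (M⁻¹ * r ^ (n + 1)) ≤ surfaceMeasure S (surfaceCube S p r) ∧
      surfaceMeasure S (surfaceCube S p r) ≤ ENNReal.ofReal (M * r ^ (n + 1))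

/-- `A` and `B` lie in different connected components of `ℝ^{n+1} ∖ S`. -/
def InDifferentComponents {n : ℕ} (S A B : Set (SpaceTime n)) : Prop :=
  ∃ a ∈ Sᶜ, ∃ b ∈ Sᶜ, connectedComponentIn Sᶜ a ≠ connectedComponentIn Sᶜ b ∧
    A ⊆ connectedComponentIn Sᶜ a ∧ B ⊆ connectedComponentIn Sᶜ b

/-- The weak time-synchronized two cube condition with constant `γ`. The two cubes have the same
size `ρ` and centres `(X₁, t')`, `(X₂, t')` with the same time coordinate, which need not be the
time coordinate of `p`. -/
def WeakTimeSyncTwoCube {n : ℕ} (S : Set (SpaceTime n)) (γ : ℝ) : Prop :=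
  ∀ (p : SpaceTime n) (r : ℝ), Admissible S p r →
    ∃ (ρ : ℝ) (p₁ p₂ : SpaceTime n), γ * r ≤ ρ ∧ ρ < r ∧ p₁.2 = p₂.2 ∧
      cube p₁ ρ ⊆ cube p r ∧ cube p₂ ρ ⊆ cube p r ∧
      InDifferentComponents S (cube p₁ ρ ∩ timeStrip S) (cube p₂ ρ ∩ timeStrip S)

/-! Graphs: below the spatial dimension is `n = d + 1`, and `X = (x, xₙ)` with `x ∈ ℝ^d`. -/

/-- `ψ : ℝ^{n-1} × ℝ → ℝ` is Lip(1,1/2) with constant `b`. -/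
def IsLipHalf {d : ℕ} (b : ℝ) (ψ : EuclideanSpace ℝ (Fin d) × ℝ → ℝ) : Prop :=
  ∀ (x y : EuclideanSpace ℝ (Fin d)) (t s : ℝ),
    |ψ (x, t) - ψ (y, s)| ≤ b * (‖x - y‖ + Real.sqrt |t - s|)

/-- The orthogonal projection `(x, xₙ, t) ↦ (x, 0, t)` onto the plane `{xₙ = 0}`, which is
identified with `ℝ^{n-1} × ℝ`. -/
def proj {d : ℕ} (p : SpaceTime (d + 1)) : EuclideanSpace ℝ (Fin d) × ℝ :=
  (WithLp.toLp 2 fun i : Fin d => p.1 i.castSucc, p.2)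

/-- The graph `{(x, xₙ, t) : xₙ = ψ(x,t)}`. -/
def graph {d : ℕ} (ψ : EuclideanSpace ℝ (Fin d) × ℝ → ℝ) : Set (SpaceTime (d + 1)) :=
  {p | p.1 (Fin.last d) = ψ (proj p)}

/-- A linear isometry of `ℝⁿ`, acting on the space variable only. -/
def spaceMap {n : ℕ} (T : EuclideanSpace ℝ (Fin n) ≃ₗᵢ[ℝ] EuclideanSpace ℝ (Fin n))
    (p : SpaceTime n) : SpaceTime n := (T p.1, p.2)

/-- `S` contains uniform big pieces of Lip(1,1/2) graphs with constants `(ε, b)`: at each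
`(X,t)` and `R` there are a rotation `T` in the space variable and a Lip(1,1/2) function `ψ`
such that, in the rotated coordinates,
`H^n(π(graph ψ ∩ Δ(X,t,R))) ≥ ε R^{n+1}`. Here `volume` is Lebesgue measure on
`ℝ^{n-1} × ℝ`, that is, standard `n`-dimensional Hausdorff measure on the plane `{xₙ = 0}`. -/
def HasBigPiecesLipHalfGraphs {d : ℕ} (S : Set (SpaceTime (d + 1))) (ε b : ℝ) : Prop :=
  ∀ (p : SpaceTime (d + 1)) (R : ℝ), Admissible S p R →
    ∃ (T : EuclideanSpace ℝ (Fin (d + 1)) ≃ₗᵢ[ℝ] EuclideanSpace ℝ (Fin (d + 1)))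
      (ψ : EuclideanSpace ℝ (Fin d) × ℝ → ℝ),
      LinearMap.det (T.toLinearEquiv : EuclideanSpace ℝ (Fin (d + 1)) →ₗ[ℝ]
        EuclideanSpace ℝ (Fin (d + 1))) = 1 ∧
      IsLipHalf b ψ ∧
      ENNReal.ofReal (ε * R ^ (d + 2)) ≤
        volume (proj '' (graph ψ ∩ spaceMap T '' surfaceCube S p R))

end SpaceTime

end

/-! The graph is cut out of the surface of first exit. Near a given point and scale, the two cube
condition gives two cubes at the same time in different components of the complement. Rotate space
so that their centres lie on one vertical line, and let `U` be the component containing the lower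
cube. Over each point `z` of a base ball, climb from the lower cube until `U` is left, at height `g
z` (`firstExit`). The upper cube misses `U`, so this happens before it is reached, and the exit
point lies on the surface. It remains to find a subset of the ball, of proportional measure, on
which `g` is Lipschitz for the parabolic distance; extending `g` from there gives `ψ`.

Suppose `z, z'` form a steep pair at scale `r`: they are at distance at most `r`, but `g z - g z'`
is at least a large multiple of `r`. Except over a small set of `z`, which a maximal inequality
controls (`measure_le_of_dense_balls`), the surface is not too dense above the ball of radius `5 r`,
and by pigeonhole some horizontal disc between the two heights misses it. The disc is below the exit
over `z`, so it lies in `U`. The two cube condition at the exit point over `z'` gives a `U`-free box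
of size `γ r` below the disc. Every vertical line through that box must therefore re-enter `U`, at a
surface point ending an excursion of length comparable to `r` (`exists_ball_subset_image`). These
points project onto a ball of radius `γ r`, so they carry surface measure at least a multiple of `r
^ D`.

The length of an excursion determines its scale: along a sufficiently sparse geometric progression
of scales the sets of such points are disjoint. Their total measure is bounded, so a second use of
the maximal inequality shows that most base points belong to steep pairs at fewer than `N` scales.
Label each point, at each scale, by its height in units of that scale modulo `q + 1`. The members of
a steep pair have different labels. Fixing one label per scale by averaging
(`exists_subset_label_eq`) keeps a proportion `(q + 1)⁻ᴺ` of the good points and destroys all steep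
pairs (`exists_lipschitzOnWith_firstExit`).

The two cubes are only controlled inside the time strip, so the construction is carried out around a
surface point away from the initial and final times (`exists_interior_time`). -/

/-! ### A covering estimate -/

/-- Weak type (1,1) bound for the maximal function of `μ` against a measure `ν` that is upper
regular of dimension `D`. -/
theorem measure_le_of_dense_balls {X : Type*} [MetricSpace X] [SecondCountableTopology X]
    [MeasurableSpace X] [OpensMeasurableSpace X] (ν μ : Measure X) {D : ℕ} {c τ R : ℝ}
    (hc : 0 ≤ c) (hτ : 0 < τ)
    (hν : ∀ x r, 0 < r → ν (Metric.ball x r) ≤ ENNReal.ofReal (c * r ^ D))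
    {E : Set X} (hE : ∀ z ∈ E, ∃ r, 0 < r ∧ r ≤ R ∧
      ENNReal.ofReal (τ * r ^ D) ≤ μ (Metric.ball z r)) :
    ν E ≤ ENNReal.ofReal (c * 6 ^ D / τ) * μ univ := by
  choose! r hr0 hrR hrμ using hE
  obtain ⟨u, huE, hdisj, hcov⟩ :=
    Vitali.exists_disjoint_subfamily_covering_enlargement_closedBall E (fun x => x) r R
      hrR 5 (by norm_num)
  have hdisj' : u.PairwiseDisjoint fun a => Metric.ball a (r a) :=
    fun a ha b hb hab => (hdisj ha hb hab).mono Metric.ball_subset_closedBall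
      Metric.ball_subset_closedBall
  have hcount : u.Countable := hdisj'.countable_of_isOpen (fun _ _ => Metric.isOpen_ball)
    (fun a ha => ⟨a, Metric.mem_ball_self (hr0 a (huE ha))⟩)
  -- The covering lemma enlarges closed balls five times; the factor 6 returns to open balls.
  have hsub : E ⊆ ⋃ b ∈ u, Metric.ball b (6 * r b) := by
    intro z hz
    obtain ⟨b, hb, hzb⟩ := hcov z hz
    have h1 := hzb (Metric.mem_closedBall_self (hr0 z hz).le)
    refine mem_iUnion₂.mpr ⟨b, hb, Metric.closedBall_subset_ball ?_ h1⟩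
    linarith [hr0 b (huE hb)]
  have hball : ∀ b ∈ u, ν (Metric.ball b (6 * r b)) ≤
      ENNReal.ofReal (c * 6 ^ D / τ) * μ (Metric.ball b (r b)) := by
    intro b hb
    have h0 := hr0 b (huE hb)
    calc ν (Metric.ball b (6 * r b)) ≤ ENNReal.ofReal (c * (6 * r b) ^ D) :=
          hν b _ (by positivity)
      _ = ENNReal.ofReal (c * 6 ^ D / τ) * ENNReal.ofReal (τ * r b ^ D) := by
          rw [← ENNReal.ofReal_mul (by positivity)]
          congr 1
          rw [mul_pow]; field_simp
      _ ≤ _ := by gcongr; exact hrμ b (huE hb)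
  calc ν E ≤ ν (⋃ b ∈ u, Metric.ball b (6 * r b)) := measure_mono hsub
    _ ≤ ∑' b : u, ν (Metric.ball (b : X) (6 * r b)) := measure_biUnion_le _ hcount _
    _ ≤ ∑' b : u, ENNReal.ofReal (c * 6 ^ D / τ) * μ (Metric.ball (b : X) (r b)) :=
        ENNReal.tsum_le_tsum fun b => hball b b.2
    _ = ENNReal.ofReal (c * 6 ^ D / τ) * μ (⋃ b ∈ u, Metric.ball b (r b)) := by
        rw [ENNReal.tsum_mul_left, measure_biUnion hcount hdisj'
          (fun b _ => Metric.isOpen_ball.measurableSet)]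
    _ ≤ _ := by gcongr; exact subset_univ _

/-! ### Selecting one label per scale by averaging -/

open Classical in
/-- The weight multiplied in when the label of the points of `B` is fixed to be `ω`. -/
noncomputable def labelWeight {X Ω : Type*} [Fintype Ω] (B : Set X) (l : X → Ω) (ω : Ω) (x : X) :
    ℝ≥0∞ :=
  if x ∈ B then (if l x = ω then (Fintype.card Ω : ℝ≥0∞) else 0) else 1

theorem measurable_labelWeight {X Ω : Type*} [Fintype Ω] [MeasurableSpace X]
    {B : Set X} {l : X → Ω} (hB : MeasurableSet B) (hl : ∀ ω, MeasurableSet (l ⁻¹' {ω})) (ω : Ω) :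
    Measurable (labelWeight B l ω) := by
  classical
  unfold labelWeight
  exact Measurable.ite hB (Measurable.ite (hl ω) measurable_const measurable_const)
    measurable_const

theorem sum_labelWeight {X Ω : Type*} [Fintype Ω] (B : Set X) (l : X → Ω) (x : X) :
    ∑ ω, labelWeight B l ω x = Fintype.card Ω := by
  classical
  unfold labelWeight
  by_cases h : x ∈ B <;> simp [h]

/-- The weights average to 1 over `ω`, so some `ω` does at least as well as the average. -/
theorem exists_lintegral_mul_labelWeight_ge {X Ω : Type*} [Fintype Ω] [Nonempty Ω]
    [MeasurableSpace X] (ν : Measure X) {B : Set X} {l : X → Ω} (hB : MeasurableSet B)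
    (hl : ∀ ω, MeasurableSet (l ⁻¹' {ω})) {f : X → ℝ≥0∞} (hf : Measurable f) :
    ∃ ω, ∫⁻ x, f x ∂ν ≤ ∫⁻ x, f x * labelWeight B l ω x ∂ν := by
  by_contra! hcon
  have h1 : ∑ ω, ∫⁻ x, f x * labelWeight B l ω x ∂ν = ∑ _ω : Ω, ∫⁻ x, f x ∂ν := by
    rw [← lintegral_finsetSum]
    · simp_rw [← Finset.mul_sum, sum_labelWeight]
      rw [lintegral_mul_const _ hf]
      simp [mul_comm]
    · exact fun ω _ => hf.mul (measurable_labelWeight hB hl ω)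
  refine absurd h1 (ne_of_lt ?_)
  exact ENNReal.sum_lt_sum_of_nonempty Finset.univ_nonempty fun ω _ => hcon ω

/-- If on `G` every point lies in at most `N` of the sets `B j`, one can fix one label `ω j`
for every `j` so that a proportion `|Ω|⁻ᴺ` of the points of `G` carry the label `ω j` for all the
sets `B j` to which they belong. -/
theorem exists_subset_label_eq {X Ω : Type*} [Fintype Ω] [Nonempty Ω] [MeasurableSpace X]
    (ν : Measure X) {G : Set X} (hG : MeasurableSet G) (hGfin : ν G ≠ ⊤) (B : ℕ → Set X)
    (l : ℕ → X → Ω) (hB : ∀ j, MeasurableSet (B j)) (hl : ∀ j ω, MeasurableSet (l j ⁻¹' {ω}))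
    (N : ℕ) (hN : ∀ x ∈ G, ∑' j, (B j).indicator (fun _ => (1 : ℝ≥0∞)) x ≤ N) :
    ∃ H ⊆ G, MeasurableSet H ∧ ν G ≤ (Fintype.card Ω : ℝ≥0∞) ^ N * ν H ∧
      ∀ j, ∀ x ∈ H, ∀ y ∈ H, x ∈ B j → y ∈ B j → l j x = l j y := by
  classical
  have hpick : ∀ (f : {f : X → ℝ≥0∞ // Measurable f}) (j : ℕ), ∃ ω,
      ∫⁻ x in G, f.1 x ∂ν ≤ ∫⁻ x in G, f.1 x * labelWeight (B j) (l j) ω x ∂ν :=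
    fun f j => exists_lintegral_mul_labelWeight_ge _ (hB j) (hl j) f.2
  choose pick hpick using hpick
  -- Labels are fixed greedily, one index at a time. `F k` is the product of the first `k` weights,
  -- and its integral over `G` never decreases.
  let F : ℕ → {f : X → ℝ≥0∞ // Measurable f} := fun k => Nat.rec ⟨fun _ => 1, measurable_const⟩
    (fun j f => ⟨fun x => f.1 x * labelWeight (B j) (l j) (pick f j) x,
      f.2.mul (measurable_labelWeight (hB j) (hl j) _)⟩) k
  have hF0 : ∀ x, (F 0).1 x = 1 := fun x => rfl
  have hFs : ∀ k x, (F (k + 1)).1 x = (F k).1 x * labelWeight (B k) (l k) (pick (F k) k) x :=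
    fun k x => rfl
  have hmono : ∀ k, ν G ≤ ∫⁻ x in G, (F k).1 x ∂ν := by
    intro k
    induction k with
    | zero => simp [hF0]
    | succ k ih => exact ih.trans ((hpick (F k) k).trans_eq (by simp only [hFs]))
  have hcard : (1 : ℝ≥0∞) ≤ Fintype.card Ω := by
    exact_mod_cast Fintype.card_pos
  have hbound : ∀ k x, (F k).1 x ≤
      (Fintype.card Ω : ℝ≥0∞) ^ ((Finset.range k).filter fun j => x ∈ B j).card := by
    intro k x
    induction k with
    | zero => simp [hF0]
    | succ k ih =>
      rw [hFs, Finset.range_add_one, Finset.filter_insert]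
      by_cases hx : x ∈ B k
      · rw [if_pos hx, Finset.card_insert_of_notMem (by simp), pow_succ]
        refine mul_le_mul' ih ?_
        unfold labelWeight
        rw [if_pos hx]
        split_ifs <;> simp
      · rw [if_neg hx]
        simpa [labelWeight, hx] using ih
  have hcount : ∀ k, ∀ x ∈ G, ((Finset.range k).filter fun j => x ∈ B j).card ≤ N := by
    intro k x hx
    have h1 : ((((Finset.range k).filter fun j => x ∈ B j).card : ℕ) : ℝ≥0∞) ≤ N := by
      refine le_trans ?_ (hN x hx)
      refine le_trans (le_of_eq ?_) (ENNReal.sum_le_tsum (Finset.range k))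
      simp [Set.indicator_apply]
    exact_mod_cast h1
  -- The survivors: points whose labels agree with all choices made so far. On them `F k` is at most
  -- `|Ω| ^ N`, so the lower bound on its integral becomes a lower bound on their measure.
  let H : ℕ → Set X := fun k => G ∩ {x | (F k).1 x ≠ 0}
  have hHm : ∀ k, MeasurableSet (H k) := fun k =>
    hG.inter ((F k).2 (measurableSet_singleton 0).compl)
  have hHanti : Antitone H := by
    refine antitone_nat_of_succ_le fun k x hx => ⟨hx.1, fun h0 => hx.2 ?_⟩
    rw [hFs, h0, zero_mul]
  have hHν : ∀ k, ν G ≤ (Fintype.card Ω : ℝ≥0∞) ^ N * ν (H k) := by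
    intro k
    calc ν G ≤ ∫⁻ x in G, (F k).1 x ∂ν := hmono k
      _ ≤ ∫⁻ x in G, (H k).indicator (fun _ => (Fintype.card Ω : ℝ≥0∞) ^ N) x ∂ν := by
          refine setLIntegral_mono' hG fun x hx => ?_
          by_cases h0 : (F k).1 x = 0
          · simp [h0]
          · rw [Set.indicator_of_mem (show x ∈ H k from ⟨hx, h0⟩)]
            exact (hbound k x).trans (pow_le_pow_right₀ hcard (hcount k x hx))
      _ ≤ ∫⁻ x, (H k).indicator (fun _ => (Fintype.card Ω : ℝ≥0∞) ^ N) x ∂ν :=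
          setLIntegral_le_lintegral _ _
      _ = _ := by rw [lintegral_indicator (hHm k)]; simp
  refine ⟨⋂ k, H k, (iInter_subset H 0).trans inter_subset_left,
    MeasurableSet.iInter hHm, ?_, ?_⟩
  · have htend := tendsto_measure_iInter_atTop (μ := ν) (fun k => (hHm k).nullMeasurableSet) hHanti
      ⟨0, ne_top_of_le_ne_top hGfin (measure_mono inter_subset_left)⟩
    have h2 := ENNReal.Tendsto.const_mul (a := (Fintype.card Ω : ℝ≥0∞) ^ N) htend
      (Or.inr (by finiteness))
    exact ge_of_tendsto' h2 hHν
  · intro j x hx y hy hxB hyB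
    have key : ∀ z ∈ ⋂ k, H k, z ∈ B j → l j z = pick (F j) j := by
      intro z hz hzB
      by_contra hne
      refine (mem_iInter.mp hz (j + 1)).2 ?_
      rw [hFs]
      simp [labelWeight, hzB, hne]
    rw [key x hx hxB, key y hy hyB]

/-! ### First exit along vertical lines -/

section FirstExit

variable {X : Type*} {U : Set (X × ℝ)}

/-- Height at which the vertical line over `z`, followed upwards from height `h₁`, leaves `U`,
cut off at height `h₂`. -/
noncomputable def firstExit (U : Set (X × ℝ)) (h₁ h₂ : ℝ) (z : X) : ℝ :=
  sInf {h | h₁ ≤ h ∧ ((z, h) ∉ U ∨ h₂ ≤ h)}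

/-- Points from which the vertical segment of length `ℓ` going downwards stays outside `U`. -/
def deepBelow (U : Set (X × ℝ)) (ℓ : ℝ) : Set (X × ℝ) :=
  {y | ∀ s ∈ Icc (0 : ℝ) ℓ, (y.1, y.2 - s) ∉ U}

theorem deepBelow_anti {ℓ ℓ' : ℝ} (h : ℓ ≤ ℓ') : deepBelow U ℓ' ⊆ deepBelow U ℓ :=
  fun _ hy s hs => hy s ⟨hs.1, hs.2.trans h⟩

theorem firstExit_le {h₁ h₂ h : ℝ} {z : X} (h1 : h₁ ≤ h) (h2 : (z, h) ∉ U ∨ h₂ ≤ h) :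
    firstExit U h₁ h₂ z ≤ h :=
  csInf_le ⟨h₁, fun _ hx => hx.1⟩ ⟨h1, h2⟩

theorem mem_of_lt_firstExit {h₁ h₂ h : ℝ} {z : X} (h1 : h₁ ≤ h) (h2 : h < firstExit U h₁ h₂ z) :
    (z, h) ∈ U := by
  by_contra hcon
  exact absurd (firstExit_le h1 (Or.inl hcon)) (not_le.mpr h2)

variable [MetricSpace X]

theorem isClosed_deepBelow (hU : IsOpen U) (ℓ : ℝ) : IsClosed (deepBelow U ℓ) := by
  have : deepBelow U ℓ = ⋂ s ∈ Icc (0 : ℝ) ℓ, (fun y : X × ℝ => (y.1, y.2 - s)) ⁻¹' Uᶜ := by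
    ext y; simp [deepBelow]
  rw [this]
  exact isClosed_biInter fun s _ => hU.isClosed_compl.preimage (by fun_prop)

theorem firstExit_mem (hU : IsOpen U) {h₁ h₂ : ℝ} (h : h₁ ≤ h₂) (z : X) :
    h₁ ≤ firstExit U h₁ h₂ z ∧ ((z, firstExit U h₁ h₂ z) ∉ U ∨ h₂ ≤ firstExit U h₁ h₂ z) := by
  have hcl : IsClosed {h | h₁ ≤ h ∧ ((z, h) ∉ U ∨ h₂ ≤ h)} := by
    have hU' : IsClosed {h : ℝ | (z, h) ∉ U} := hU.isClosed_compl.preimage (by fun_prop)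
    exact isClosed_Ici.inter (hU'.union isClosed_Ici)
  exact hcl.csInf_mem ⟨h₂, h, Or.inr le_rfl⟩ ⟨h₁, fun x hx => hx.1⟩

/-- Sublevel sets are projections of closed sets along a compact interval of heights, hence closed:
the exit height is lower semicontinuous. -/
theorem measurable_firstExit [MeasurableSpace X] [OpensMeasurableSpace X] (hU : IsOpen U)
    {h₁ h₂ : ℝ} (h : h₁ ≤ h₂) : Measurable (firstExit U h₁ h₂) := by
  refine measurable_of_Iic fun c => IsClosed.measurableSet ?_
  have : firstExit U h₁ h₂ ⁻¹' Iic c =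
      Prod.fst '' ((Uᶜ ∪ {y : X × ℝ | h₂ ≤ y.2}) ∩ univ ×ˢ Icc h₁ c) := by
    ext z
    simp only [mem_preimage, mem_Iic, mem_image, Prod.exists, exists_and_right, exists_eq_right]
    constructor
    · intro hz
      obtain ⟨h1, h2⟩ := firstExit_mem hU h z
      exact ⟨_, h2, mem_univ _, h1, hz⟩
    · rintro ⟨k, hk, -, hk1, hk2⟩
      exact (firstExit_le hk1 hk).trans hk2
  rw [this]
  have hcl : IsClosed (Uᶜ ∪ {y : X × ℝ | h₂ ≤ y.2}) :=
    hU.isClosed_compl.union (isClosed_le continuous_const continuous_snd)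
  have h2 := isClosedMap_fst_of_compactSpace (X := X) (Y := Icc h₁ c) _
    (hcl.preimage (f := fun y : X × Icc h₁ c => (y.1, (y.2 : ℝ))) (by fun_prop))
  convert h2 using 1
  ext z
  simp only [mem_image, mem_inter_iff, mem_prod, mem_univ, true_and, Prod.exists, exists_and_right,
    exists_eq_right, mem_preimage, Subtype.exists]
  exact ⟨fun ⟨k, hk, hk'⟩ => ⟨k, hk', hk⟩, fun ⟨k, hk', hk⟩ => ⟨k, hk, hk'⟩⟩

/-- A preconnected set that meets `U` but not the frontier of `U` lies in `U`. -/
theorem IsPreconnected.subset_of_disjoint_frontier {Y : Type*} [TopologicalSpace Y] {A V : Set Y}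
    (hA : IsPreconnected A) (hV : IsOpen V) (hAV : (A ∩ V).Nonempty)
    (hd : Disjoint A (frontier V)) : A ⊆ V := by
  refine hA.subset_of_closure_inter_subset hV hAV fun y hy => ?_
  by_contra hyV
  exact disjoint_left.mp hd hy.2 (by rw [hV.frontier_eq]; exact ⟨hy.1, hyV⟩)

/-- Above a point outside `U` and below a point of `U` on the same vertical line there is a point
of the frontier of `U`, such that the segment below it is outside `U`. -/
theorem exists_reentry (hU : IsOpen U) {w : X} {a k : ℝ} (hak : a ≤ k)
    (ha : (w, a) ∉ U) (hk : (w, k) ∈ U) :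
    ∃ t, a ≤ t ∧ t < k ∧ (w, t) ∈ frontier U ∧ ∀ h ∈ Icc a t, (w, h) ∉ U := by
  -- The required height is the infimum of `A`. Since `U` is open, the infimum is not attained
  -- unless it equals `a`, which `ha` excludes.
  set A : Set ℝ := {h | a ≤ h ∧ (w, h) ∈ U} with hA
  have hne : A.Nonempty := ⟨k, hak, hk⟩
  have hbdd : BddBelow A := ⟨a, fun h hh => hh.1⟩
  have hcont : Continuous fun h : ℝ => (w, h) := by fun_prop
  have hVo : IsOpen {h : ℝ | (w, h) ∈ U} := hU.preimage hcont
  have hat : a ≤ sInf A := le_csInf hne fun h hh => hh.1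
  have hcl : (w, sInf A) ∈ closure U :=
    map_mem_closure hcont (csInf_mem_closure hne hbdd) fun h hh => hh.2
  have hlow : ∀ h ∈ Ico a (sInf A), (w, h) ∉ U := fun h hh hU' =>
    absurd (csInf_le hbdd ⟨hh.1, hU'⟩) (not_le.mpr hh.2)
  have hnot : (w, sInf A) ∉ U := by
    intro hin
    rcases hat.eq_or_lt with h0 | h0
    · rw [← h0] at hin; exact ha hin
    · obtain ⟨ε, hε, hball⟩ := Metric.isOpen_iff.mp hVo _ hin
      have h1 : max a (sInf A - ε / 2) ∈ Metric.ball (sInf A) ε := by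
        rw [Metric.mem_ball, Real.dist_eq, abs_lt]
        constructor
        · linarith [le_max_right a (sInf A - ε / 2)]
        · linarith [max_lt h0 (by linarith : sInf A - ε / 2 < sInf A)]
      exact hlow _ ⟨le_max_left _ _, max_lt h0 (by linarith)⟩ (hball h1)
  refine ⟨sInf A, hat, lt_of_le_of_ne (csInf_le hbdd ⟨hak, hk⟩) ?_, ?_, ?_⟩
  · intro h; rw [h] at hnot; exact hnot hk
  · rw [hU.frontier_eq]; exact ⟨hcl, hnot⟩
  · intro h hh
    rcases hh.2.eq_or_lt with h0 | h0
    · rw [h0]; exact hnot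
    · exact hlow h ⟨hh.1, h0⟩

end FirstExit

/-! ### Crossing regions and steep pairs -/

/-- Over the ball `ball z₀ ρ`, the open set `U` contains the layer of heights `[h₁, h₁ + ρ]` and
misses the height `h₂`; its frontier lies in the closed set `S`, which between these heights is
lower regular of dimension `D` for `μ`, has `U`-free boxes at all places and scales, and has
projections controlled by `μ`. -/
structure IsCrossingRegion {X : Type*} [MetricSpace X] [MeasurableSpace X] (ν : Measure X)
    (μ : Measure (X × ℝ)) (U S : Set (X × ℝ)) (z₀ : X) (ρ h₁ h₂ : ℝ) (D : ℕ) (c₀ c₃ γ : ℝ) :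
    Prop where
  rho_pos : 0 < ρ
  isOpen : IsOpen U
  isClosed : IsClosed S
  frontier_subset : frontier U ⊆ S
  lt : h₁ < h₂
  lower : ∀ z ∈ Metric.ball z₀ ρ, ∀ h ∈ Icc h₁ (h₁ + ρ), (z, h) ∈ U
  upper : ∀ z ∈ Metric.ball z₀ ρ, (z, h₂) ∉ U
  projection_le : ∀ A ⊆ S ∩ Metric.ball z₀ ρ ×ˢ Icc h₁ h₂,
    ν (Prod.fst '' A) ≤ ENNReal.ofReal c₀ * μ A
  lower_regular : ∀ y ∈ S, y.1 ∈ Metric.ball z₀ ρ → y.2 ∈ Icc h₁ h₂ → ∀ r, 0 < r → r ≤ ρ →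
    ENNReal.ofReal (c₃ * r ^ D) ≤ μ (Metric.ball y.1 r ×ˢ Ioo (y.2 - r) (y.2 + r))
  corkscrew : ∀ y ∈ S, y.1 ∈ Metric.ball z₀ ρ → y.2 ∈ Icc h₁ h₂ → ∀ r, 0 < r → r ≤ ρ →
    ∃ q : X × ℝ, q.1 ∈ Metric.ball y.1 r ∧ q.2 ∈ Ioo (y.2 - r) (y.2 + r) ∧
      Disjoint (Metric.ball q.1 (γ * r) ×ˢ Ioo (q.2 - γ * r) (q.2 + γ * r)) U

namespace IsCrossingRegion

variable {X : Type*} [MetricSpace X] [MeasurableSpace X] {ν : Measure X}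
  {μ : Measure (X × ℝ)} {U S : Set (X × ℝ)} {z₀ : X} {ρ h₁ h₂ : ℝ} {D : ℕ} {c₀ c₃ γ : ℝ}

theorem firstExit_le (H : IsCrossingRegion ν μ U S z₀ ρ h₁ h₂ D c₀ c₃ γ) {z : X} :
    firstExit U h₁ h₂ z ≤ h₂ :=
  _root_.firstExit_le H.lt.le (Or.inr le_rfl)

theorem firstExit_notMem (H : IsCrossingRegion ν μ U S z₀ ρ h₁ h₂ D c₀ c₃ γ) {z : X}
    (hz : z ∈ Metric.ball z₀ ρ) : (z, firstExit U h₁ h₂ z) ∉ U := by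
  rcases (firstExit_mem H.isOpen H.lt.le z).2 with h | h
  · exact h
  · rw [le_antisymm H.firstExit_le h]; exact H.upper z hz

theorem add_lt_firstExit (H : IsCrossingRegion ν μ U S z₀ ρ h₁ h₂ D c₀ c₃ γ) {z : X}
    (hz : z ∈ Metric.ball z₀ ρ) : h₁ + ρ < firstExit U h₁ h₂ z := by
  by_contra! hcon
  exact H.firstExit_notMem hz (H.lower z hz _ ⟨(firstExit_mem H.isOpen H.lt.le z).1, hcon⟩)

theorem firstExit_mem_surface (H : IsCrossingRegion ν μ U S z₀ ρ h₁ h₂ D c₀ c₃ γ) {z : X}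
    (hz : z ∈ Metric.ball z₀ ρ) : (z, firstExit U h₁ h₂ z) ∈ S := by
  refine H.frontier_subset ?_
  rw [H.isOpen.frontier_eq]
  refine ⟨?_, H.firstExit_notMem hz⟩
  have hcont : Continuous fun h : ℝ => (z, h) := by fun_prop
  have hlt : h₁ < firstExit U h₁ h₂ z := by linarith [H.add_lt_firstExit hz, H.rho_pos]
  refine map_mem_closure hcont (s := Ico h₁ (firstExit U h₁ h₂ z)) ?_
    fun h hh => mem_of_lt_firstExit hh.1 hh.2
  rw [closure_Ico hlt.ne]
  exact ⟨hlt.le, le_rfl⟩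

/-- Where the surface is not too dense over a ball, one of `m` equidistant levels of a slightly
smaller ball misses it. -/
theorem exists_level_disjoint [OpensMeasurableSpace X] [SecondCountableTopology X]
    (H : IsCrossingRegion ν μ U S z₀ ρ h₁ h₂ D c₀ c₃ γ) {z : X}
    (hz : z ∈ Metric.ball z₀ (ρ / 2)) {r : ℝ} (hr : 0 < r) (hrρ : r ≤ ρ / 8) {m : ℕ} {a : ℝ}
    (ha : h₁ ≤ a) (ham : a + 2 * r * m ≤ h₂)
    (hdens : μ (Metric.ball z (5 * r) ×ˢ univ) < ENNReal.ofReal (m * c₃ * r ^ D)) :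
    ∃ i < m, ∀ w ∈ Metric.ball z (4 * r), (w, a + 2 * r * i) ∉ S := by
  -- If every level were hit, boxes of radius `r` around the hits, disjoint because the levels are
  -- `2 r` apart, would all lie in the cylinder of radius `4 r + r` and make it too dense.
  by_contra! hcon
  have : Nonempty X := ⟨z⟩
  choose! w hw hwS using hcon
  have hsub : ∀ i < m, Metric.ball (w i) r ⊆ Metric.ball z (5 * r) := fun i hi =>
    Metric.ball_subset_ball' (by linarith [Metric.mem_ball.mp (hw i hi)])
  have hbox : ∀ i < m, ENNReal.ofReal (c₃ * r ^ D) ≤ μ (Metric.ball (w i) r ×ˢ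
      Ioo (a + 2 * r * i - r) (a + 2 * r * i + r)) := by
    intro i hi
    have him : (i : ℝ) ≤ m := by exact_mod_cast hi.le
    refine H.lower_regular _ (hwS i hi) ?_ ⟨?_, ?_⟩ r hr (by linarith [H.rho_pos])
    · have h1 := Metric.mem_ball.mp (hw i hi)
      have h2 := Metric.mem_ball.mp hz
      exact Metric.mem_ball.mpr (by linarith [dist_triangle (w i) z z₀])
    · have : 0 ≤ 2 * r * i := by positivity
      simp only; linarith
    · simp only
      nlinarith
  refine absurd hdens (not_lt.mpr ?_)
  calc ENNReal.ofReal (m * c₃ * r ^ D)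
      = ∑ i ∈ Finset.range m, ENNReal.ofReal (c₃ * r ^ D) := by
        rw [Finset.sum_const, Finset.card_range, nsmul_eq_mul, mul_assoc,
          ENNReal.ofReal_mul (by positivity), ENNReal.ofReal_natCast]
    _ ≤ ∑ i ∈ Finset.range m, μ (Metric.ball (w i) r ×ˢ
          Ioo (a + 2 * r * i - r) (a + 2 * r * i + r)) :=
        Finset.sum_le_sum fun i hi => hbox i (Finset.mem_range.mp hi)
    _ = μ (⋃ i ∈ Finset.range m, Metric.ball (w i) r ×ˢ
          Ioo (a + 2 * r * i - r) (a + 2 * r * i + r)) := by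
        rw [measure_biUnion_finset]
        · intro i _ j _ hij
          refine disjoint_left.mpr fun y hyi hyj => hij ?_
          have h1 := hyi.2
          have h2 := hyj.2
          simp only [mem_Ioo] at h1 h2
          have h3 : (i : ℝ) < j + 1 := by
            by_contra! hc; nlinarith
          have h4 : (j : ℝ) < i + 1 := by
            by_contra! hc; nlinarith
          have h5 : i < j + 1 := by exact_mod_cast h3
          have h6 : j < i + 1 := by exact_mod_cast h4
          omega
        · exact fun i _ => Metric.isOpen_ball.measurableSet.prod measurableSet_Ioo
    _ ≤ _ := by
        refine measure_mono (iUnion₂_subset fun i hi => ?_)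
        exact prod_mono (hsub i (Finset.mem_range.mp hi)) (subset_univ _)

/-- A steep pair of first exit points forces the lines over a whole ball to re-enter `U` after
an excursion outside `U` whose length is comparable to the height of the pair. -/
theorem exists_ball_subset_image [OpensMeasurableSpace X] [SecondCountableTopology X]
    (H : IsCrossingRegion ν μ U S z₀ ρ h₁ h₂ D c₀ c₃ γ) (hγ₀ : 0 < γ) (hγ₁ : γ ≤ 1)
    (hconn : ∀ (x : X) (r : ℝ), IsPreconnected (Metric.ball x r)) {z z' : X}
    (hz : z ∈ Metric.ball z₀ (ρ / 2)) (hz' : z' ∈ Metric.ball z₀ (ρ / 2))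
    {r : ℝ} (hr : 0 < r) (hrρ : r ≤ ρ / 8) {m : ℕ}
    (hdens : μ (Metric.ball z (5 * r) ×ˢ univ) < ENNReal.ofReal (m * c₃ * r ^ D))
    (hdist : dist z z' ≤ r)
    (hsteep : (2 * m + 1) * r ≤ firstExit U h₁ h₂ z - firstExit U h₁ h₂ z') :
    ∃ q : X, Metric.ball q (γ * r) ⊆ Prod.fst ''
      ((S ∩ (deepBelow U (γ * r / 2) \ deepBelow U ((2 * m + 1) * r))) ∩
        (Metric.ball z (4 * r) ∩ Metric.ball z' (4 * r) ∩ Metric.ball z₀ ρ) ×ˢ Icc h₁ h₂) := by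
  have hρ := H.rho_pos
  have hzρ : z ∈ Metric.ball z₀ ρ := Metric.ball_subset_ball (by linarith) hz
  have hzρ' : z' ∈ Metric.ball z₀ ρ := Metric.ball_subset_ball (by linarith) hz'
  set g := firstExit U h₁ h₂ with hg
  have hgz : g z ≤ h₂ := H.firstExit_le
  have hgz' : h₁ + ρ < g z' := H.add_lt_firstExit hzρ'
  have hmr : 0 ≤ 2 * r * m := by positivity
  have hsteep' : g z' + r + 2 * r * m ≤ g z := by linarith
  -- Start of the excursion: a `U`-free box close to the exit point over `z'`.
  obtain ⟨q, hq1, hq2, hqU⟩ := H.corkscrew (z', g z') (H.firstExit_mem_surface hzρ') hzρ'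
    ⟨by simp only; linarith, H.firstExit_le⟩ r hr (by linarith)
  simp only [mem_Ioo] at hq2
  refine ⟨q.1, fun w hw => ?_⟩
  have hγr : 0 < γ * r := by positivity
  have hγr1 : γ * r ≤ r := by nlinarith
  have hq1' := Metric.mem_ball.mp hq1
  have hw' := Metric.mem_ball.mp hw
  have hwz' : dist w z' < 2 * r := by
    have := dist_triangle w q.1 z'
    simp only at hq1'
    linarith
  have hwz : dist w z < 4 * r := by
    have := dist_triangle w z' z
    rw [dist_comm] at hdist
    linarith
  have hwρ : w ∈ Metric.ball z₀ ρ := by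
    have := dist_triangle w z' z₀
    have := Metric.mem_ball.mp hz'
    exact Metric.mem_ball.mpr (by linarith)
  have hqoff : ∀ h ∈ Ioo (q.2 - γ * r) (q.2 + γ * r), (w, h) ∉ U := fun h hh hU =>
    disjoint_left.mp hqU (show (w, h) ∈ _ from ⟨hw, hh⟩) hU
  -- End of the excursion: a level free of `S` above the box and below the exit over `z`. The disc
  -- at this level is connected and contains a point of `U` over `z`, so it lies in `U`. Levels
  -- start at `g z' + r` because the centre of the box may be that high.
  obtain ⟨i, him, hi⟩ := H.exists_level_disjoint hz hr hrρ (a := g z' + r)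
    (by linarith) (by linarith) hdens
  have him' : (i : ℝ) + 1 ≤ m := by exact_mod_cast him
  have hi0 : 0 ≤ 2 * r * i := by positivity
  set k := g z' + r + 2 * r * i with hk
  have hkz : k < g z := by nlinarith
  have hwk : (w, k) ∈ U := by
    have hA : IsPreconnected ((fun v : X => (v, k)) '' Metric.ball z (4 * r)) :=
      (hconn z (4 * r)).image _ (by fun_prop)
    refine hA.subset_of_disjoint_frontier H.isOpen
      ⟨(z, k), ⟨z, Metric.mem_ball_self (by linarith), rfl⟩,
        mem_of_lt_firstExit (by linarith) hkz⟩ ?_ ⟨w, hwz, rfl⟩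
    refine disjoint_left.mpr ?_
    rintro _ ⟨v, hv, rfl⟩ hvF
    exact hi v hv (H.frontier_subset hvF)
  obtain ⟨t, hqt, htk, htF, htU⟩ := exists_reentry H.isOpen (w := w) (a := q.2) (k := k)
    (by linarith [hq2.2]) (hqoff _ ⟨by linarith, by linarith⟩) hwk
  refine ⟨(w, t), ⟨⟨H.frontier_subset htF, ?_, ?_⟩, ⟨⟨?_, ?_⟩, hwρ⟩, ?_, ?_⟩, rfl⟩
  -- The segment of length `γ r / 2` below the re-entry point runs through the excursion and then
  -- possibly through the lower half of the box.
  · intro s hs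
    by_cases hst : q.2 ≤ t - s
    · exact htU _ ⟨hst, by linarith [hs.1]⟩
    · push Not at hst
      exact hqoff _ ⟨by simp only; linarith [hs.2], by simp only; linarith⟩
  -- The excursion is not longer than `(2 m + 1) r`: going down that far meets either the layer at
  -- height `h₁` or a second disc inside `U`, found by the same pigeonhole.
  · intro hdeep
    have hh : h₁ < t - (2 * m + 1) * r := by
      by_contra! hcon
      refine hdeep (t - h₁) ⟨by linarith [hq2.1], by linarith⟩ ?_
      simp only [sub_sub_cancel]
      exact H.lower w hwρ h₁ ⟨le_rfl, by linarith⟩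
    obtain ⟨i', him2, hi2⟩ := H.exists_level_disjoint hz hr hrρ
      (a := t - (2 * m + 1) * r) hh.le (by linarith) hdens
    have him2' : (i' : ℝ) + 1 ≤ m := by exact_mod_cast him2
    have hi20 : 0 ≤ 2 * r * i' := by positivity
    have hle : 2 * r * i' ≤ 2 * r * m := by nlinarith
    set k' := t - (2 * m + 1) * r + 2 * r * i' with hk'
    have hkt : k' ≤ t := by nlinarith
    have hA : IsPreconnected ((fun v : X => (v, k')) '' Metric.ball z (4 * r)) :=
      (hconn z (4 * r)).image _ (by fun_prop)
    have hwk' : (w, k') ∈ U := by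
      refine hA.subset_of_disjoint_frontier H.isOpen
        ⟨(z, k'), ⟨z, Metric.mem_ball_self (by linarith), rfl⟩,
          mem_of_lt_firstExit (by linarith) (show k' < firstExit U h₁ h₂ z by linarith)⟩ ?_ ⟨w, hwz, rfl⟩
      refine disjoint_left.mpr ?_
      rintro _ ⟨v, hv, rfl⟩ hvF
      exact hi2 v hv (H.frontier_subset hvF)
    refine hdeep (t - k') ⟨by linarith, by linarith⟩ ?_
    simpa using hwk'
  · exact Metric.mem_ball.mpr hwz
  · exact Metric.mem_ball.mpr (by linarith)
  · simp only; linarith [hq2.1]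
  · simp only; linarith

end IsCrossingRegion

/-! ### Counting scales: the Lipschitz piece -/

/-- This is the weak type bound for the push-forward of `μ` to the base, where vertical cylinders
become balls. It serves twice: for density of the surface and for excursions at one scale. -/
theorem measure_setOf_le_cylinder {X : Type*} [MetricSpace X] [SecondCountableTopology X]
    [MeasurableSpace X] [OpensMeasurableSpace X] (ν : Measure X) (μ : Measure (X × ℝ)) {D : ℕ}
    {c R κ τ : ℝ} (hc : 0 ≤ c) (hτ : 0 < τ) (hκ : 0 < κ)
    (hν : ∀ x r, 0 < r → ν (Metric.ball x r) ≤ ENNReal.ofReal (c * r ^ D)) :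
    ν {z | ∃ r, 0 < r ∧ r ≤ R ∧
      ENNReal.ofReal (τ * r ^ D) ≤ μ (Metric.ball z (κ * r) ×ˢ univ)} ≤
      ENNReal.ofReal (c * (6 * κ) ^ D / τ) * μ univ := by
  have h := measure_le_of_dense_balls (X := X) ν (μ.map Prod.fst) (D := D) (c := c)
    (τ := τ / κ ^ D) (R := κ * R) hc (by positivity) hν
    (E := {z | ∃ r, 0 < r ∧ r ≤ R ∧
      ENNReal.ofReal (τ * r ^ D) ≤ μ (Metric.ball z (κ * r) ×ˢ univ)}) ?_
  · rw [Measure.map_apply measurable_fst MeasurableSet.univ, preimage_univ] at h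
    convert h using 3
    rw [mul_pow]
    field_simp
  · rintro z ⟨r, hr, hrR, hrμ⟩
    refine ⟨κ * r, by positivity, by gcongr, ?_⟩
    rw [Measure.map_apply measurable_fst Metric.isOpen_ball.measurableSet, ← prod_univ]
    convert hrμ using 2
    rw [mul_pow]
    field_simp

/-- Every number in `(0, K q r)` lies in one of the intervals `[K r q⁻ʲ, K q r q⁻ʲ)`. -/
theorem exists_geometric_scale {K q r δ : ℝ} (hq : 1 < q)
    (hδ : 0 < δ) (hδ' : δ < K * q * r) :
    ∃ j : ℕ, K * (r / q ^ j) ≤ δ ∧ δ < K * q * (r / q ^ j) := by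
  classical
  have hex : ∃ j : ℕ, K * (r / q ^ j) ≤ δ := by
    have h1 : Filter.Tendsto (fun j : ℕ => K * (r / q ^ j)) Filter.atTop (nhds (K * 0)) :=
      ((tendsto_const_nhds (x := r)).div_atTop (tendsto_pow_atTop_atTop_of_one_lt hq)).const_mul K
    rw [mul_zero] at h1
    exact (h1.eventually_le_const hδ).exists
  refine ⟨Nat.find hex, Nat.find_spec hex, ?_⟩
  rcases h : Nat.find hex with _ | k
  · simpa using hδ'
  · have h1 := Nat.find_min hex (m := k) (by omega)
    push Not at h1
    refine h1.trans_eq ?_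
    have : q ≠ 0 := by linarith
    rw [pow_succ]
    field_simp

/-- The two floors differ by at least 1 and by less than `q + 1`, so they are not congruent. With
heights measured in a suitable unit, this separates the labels of a steep pair. -/
theorem intCast_floor_ne {q : ℕ} {a a' : ℝ} (h1 : 1 ≤ a - a') (hq : a - a' < q) :
    ((⌊a⌋ : ℤ) : ZMod (q + 1)) ≠ ((⌊a'⌋ : ℤ) : ZMod (q + 1)) := by
  intro h
  rw [eq_comm, ZMod.intCast_eq_intCast_iff_dvd_sub] at h
  have h2 := Int.floor_le a
  have h3 := Int.lt_floor_add_one a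
  have h4 := Int.floor_le a'
  have h5 := Int.lt_floor_add_one a'
  have h6 : (0 : ℝ) < ((⌊a⌋ - ⌊a'⌋ : ℤ) : ℝ) := by push_cast; linarith
  have h7 : ((⌊a⌋ - ⌊a'⌋ : ℤ) : ℝ) < ((q + 1 : ℕ) : ℤ) := by push_cast; linarith
  have h8 : 0 < ⌊a⌋ - ⌊a'⌋ := by exact_mod_cast h6
  have h9 : ⌊a⌋ - ⌊a'⌋ < ((q + 1 : ℕ) : ℤ) := by exact_mod_cast h7
  exact absurd (Int.le_of_dvd h8 h) (not_le.mpr h9)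

theorem IsCrossingRegion.measurableSet_excursion {X : Type*} [MetricSpace X] [MeasurableSpace X]
    [BorelSpace X] {ν : Measure X} {μ : Measure (X × ℝ)} {U S : Set (X × ℝ)} {z₀ : X}
    {ρ h₁ h₂ : ℝ} {D : ℕ} {c₀ c₃ γ : ℝ}
    (H : IsCrossingRegion ν μ U S z₀ ρ h₁ h₂ D c₀ c₃ γ) (a b : ℝ) :
    MeasurableSet (S ∩ (deepBelow U a \ deepBelow U b)) :=
  H.isClosed.measurableSet.inter ((isClosed_deepBelow H.isOpen _).measurableSet.diff
    (isClosed_deepBelow H.isOpen _).measurableSet)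

namespace IsCrossingRegion

variable {X : Type*} [MetricSpace X] [MeasurableSpace X] [BorelSpace X]
  [SecondCountableTopology X] {ν : Measure X} {μ : Measure (X × ℝ)} {U S : Set (X × ℝ)} {z₀ : X}
  {ρ h₁ h₂ : ℝ} {D : ℕ} {c₀ c₁ c₃ γ : ℝ}

/-- Both members of a steep pair see a definite amount of the surface points that end an excursion
of comparable length. -/
theorem le_measure_excursion (H : IsCrossingRegion ν μ U S z₀ ρ h₁ h₂ D c₀ c₃ γ)
    (hγ₀ : 0 < γ) (hγ₁ : γ ≤ 1) (hc₀ : 0 < c₀)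
    (hconn : ∀ (x : X) (r : ℝ), IsPreconnected (Metric.ball x r))
    (hν : ∀ x r, 0 < r → ENNReal.ofReal (c₁ * r ^ D) ≤ ν (Metric.ball x r)) {z z' : X}
    (hz : z ∈ Metric.ball z₀ (ρ / 2)) (hz' : z' ∈ Metric.ball z₀ (ρ / 2))
    {r : ℝ} (hr : 0 < r) (hrρ : r ≤ ρ / 8) {m : ℕ}
    (hdens : μ (Metric.ball z (5 * r) ×ˢ univ) < ENNReal.ofReal (m * c₃ * r ^ D))
    (hdist : dist z z' ≤ r)
    (hsteep : (2 * m + 1) * r ≤ firstExit U h₁ h₂ z - firstExit U h₁ h₂ z') :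
    ∀ v, v = z ∨ v = z' → ENNReal.ofReal (c₁ * γ ^ D / c₀ * r ^ D) ≤
      μ.restrict (S ∩ (deepBelow U (γ * r / 2) \ deepBelow U ((2 * m + 1) * r)))
        (Metric.ball v (4 * r) ×ˢ univ) := by
  obtain ⟨q, hq⟩ := H.exists_ball_subset_image hγ₀ hγ₁ hconn hz hz' hr hrρ hdens hdist hsteep
  intro v hv
  rw [Measure.restrict_apply (Metric.isOpen_ball.measurableSet.prod MeasurableSet.univ)]
  have h1 : ENNReal.ofReal (c₁ * (γ * r) ^ D) ≤ ENNReal.ofReal c₀ * μ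
      (Metric.ball v (4 * r) ×ˢ univ ∩
        (S ∩ (deepBelow U (γ * r / 2) \ deepBelow U ((2 * m + 1) * r)))) := by
    refine ((hν q _ (by positivity)).trans (measure_mono hq)).trans
      ((H.projection_le _ ?_).trans ?_)
    · rintro y ⟨⟨hy1, -⟩, ⟨-, hy2⟩, hy3⟩
      exact ⟨hy1, hy2, hy3⟩
    · refine mul_le_mul_right (measure_mono ?_) _
      rintro y ⟨hy1, ⟨hy2, -⟩, -⟩
      refine ⟨⟨?_, mem_univ _⟩, hy1⟩
      rcases hv with rfl | rfl
      exacts [hy2.1, hy2.2]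
  -- The projected ball has radius `γ * r`; dividing by the projection constant `c₀` gives the mass
  -- bound.
  rw [← ENNReal.mul_le_mul_iff_right (a := ENNReal.ofReal c₀) (by simpa using hc₀)
    ENNReal.ofReal_ne_top]
  refine le_trans (le_of_eq ?_) h1
  rw [← ENNReal.ofReal_mul hc₀.le, mul_pow]
  congr 1
  field_simp

end IsCrossingRegion

/-- In a crossing region, the first exit surface coincides with a Lipschitz graph over a subset of
proportional measure. -/
theorem exists_lipschitzOnWith_firstExit {X : Type*} [MetricSpace X] [MeasurableSpace X]
    [BorelSpace X] [SecondCountableTopology X] (ν : Measure X) (D : ℕ)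
    {c₀ c₁ c₂ c₃ c₄ γ A : ℝ} (hc₀ : 0 < c₀) (hc₁ : 0 < c₁) (hc₂ : 0 < c₂) (hc₃ : 0 < c₃)
    (hc₄ : 0 < c₄) (hγ₀ : 0 < γ) (hγ₁ : γ ≤ 1) (hA : 0 ≤ A)
    (hconn : ∀ (x : X) (r : ℝ), IsPreconnected (Metric.ball x r))
    (hν₁ : ∀ x r, 0 < r → ENNReal.ofReal (c₁ * r ^ D) ≤ ν (Metric.ball x r))
    (hν₂ : ∀ x r, 0 < r → ν (Metric.ball x r) ≤ ENNReal.ofReal (c₂ * r ^ D)) :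
    ∃ (ε : ℝ) (b : NNReal), 0 < ε ∧ ∀ (μ : Measure (X × ℝ)) (U S : Set (X × ℝ)) (z₀ : X)
      (ρ h₁ h₂ : ℝ), IsCrossingRegion ν μ U S z₀ ρ h₁ h₂ D c₀ c₃ γ → h₂ - h₁ ≤ A * ρ →
      μ univ ≤ ENNReal.ofReal (c₄ * ρ ^ D) →
      ∃ F ⊆ Metric.ball z₀ ρ, LipschitzOnWith b (firstExit U h₁ h₂) F ∧
        ENNReal.ofReal (ε * ρ ^ D) ≤ ν F := by
  -- `m` makes the over-dense set `B₀` at most a quarter of the lower bound for the measure of the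
  -- half ball.
  obtain ⟨m, hm⟩ := exists_nat_gt (c₂ * (6 * 5) ^ D / c₃ * c₄ / (c₁ * (1 / 2) ^ D / 4))
  have hm0 : (0 : ℝ) < m := lt_of_le_of_lt (by positivity) hm
  set K : ℝ := 2 * m + 1 with hK
  -- The ratio of consecutive scales. The first bound makes excursions at different scales disjoint;
  -- the second makes the coarsest scale exceed every possible height difference.
  obtain ⟨q, hq⟩ := exists_nat_gt (max (2 * K / γ) (8 * A + 1))
  have hqK : 2 * K / γ < q := (le_max_left _ _).trans_lt hq
  have hqA : 8 * A + 1 < q := (le_max_right _ _).trans_lt hq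
  have hq1 : (1 : ℝ) < q := by linarith
  have hK1 : 1 ≤ K := by linarith
  set κ : ℝ := c₁ * γ ^ D / c₀ with hκ
  have hκ0 : 0 < κ := by positivity
  set C₅ : ℝ := c₂ * (6 * 4) ^ D / κ * c₄ with hC₅
  -- Chebyshev: points counted at `N` or more scales fill at most another quarter.
  obtain ⟨N, hN⟩ := exists_nat_gt (C₅ / (c₁ * (1 / 2) ^ D / 4))
  have hN0 : (0 : ℝ) < N := lt_of_le_of_lt (by positivity) hN
  refine ⟨c₁ * (1 / 2) ^ D / 2 / (q + 1) ^ N, (K * q).toNNReal, by positivity, ?_⟩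
  intro μ U S z₀ ρ h₁ h₂ H hheight hμ
  have hρ := H.rho_pos
  set g := firstExit U h₁ h₂ with hg
  set r : ℕ → ℝ := fun j => ρ / 8 / (q : ℝ) ^ j with hr
  have hr0 : ∀ j, 0 < r j := fun j => by positivity
  have hrρ : ∀ j, r j ≤ ρ / 8 := fun j => div_le_self (by positivity) (one_le_pow₀ hq1.le)
  set a : ℝ := c₁ * (1 / 2) ^ D * ρ ^ D with ha
  have ha0 : 0 < a := by positivity
  -- points over which the surface is too dense
  set B₀ := {z | ∃ r, 0 < r ∧ r ≤ ρ / 8 ∧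
      ENNReal.ofReal (m * c₃ * r ^ D) ≤ μ (Metric.ball z (5 * r) ×ˢ univ)} with hB₀
  have hνB₀ : ν B₀ ≤ ENNReal.ofReal (a / 4) := by
    refine (measure_setOf_le_cylinder ν μ hc₂.le (by positivity) (by norm_num) hν₂).trans ?_
    refine (mul_le_mul_right hμ _).trans ?_
    rw [← ENNReal.ofReal_mul (by positivity)]
    refine ENNReal.ofReal_le_ofReal ?_
    have h1 := hm.le
    rw [div_le_iff₀ (by positivity)] at h1
    have h2 : c₂ * (6 * 5) ^ D / (m * c₃) * (c₄ * ρ ^ D) =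
        (c₂ * (6 * 5) ^ D / c₃ * c₄) / m * ρ ^ D := by field_simp
    have h3 : a / 4 = (c₁ * (1 / 2) ^ D / 4) * ρ ^ D := by rw [ha]; ring
    rw [h2, h3]
    refine mul_le_mul_of_nonneg_right ?_ (by positivity)
    rw [div_le_iff₀ hm0]
    linarith
  -- excursions at the different scales, and the points that see many of them
  set E : ℕ → Set (X × ℝ) := fun j =>
    S ∩ (deepBelow U (γ * r j / 2) \ deepBelow U (K * r j)) with hE
  have hEm : ∀ j, MeasurableSet (E j) := fun j => H.measurableSet_excursion _ _
  have hEdisj : Pairwise (Function.onFun Disjoint E) := by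
    have key : ∀ i j, i < j → Disjoint (E i) (E j) := by
      intro i j hij
      refine disjoint_left.mpr fun y hi hj => hj.2.2 (deepBelow_anti ?_ hi.2.1)
      have h1 : r j ≤ r i / q := by
        rw [hr]
        simp only
        rw [div_div (ρ / 8), ← pow_succ]
        gcongr
        exacts [hq1.le, hij]
      have h2 : K / q ≤ γ / 2 := by
        rw [div_lt_iff₀ hγ₀] at hqK
        rw [div_le_iff₀ (by linarith)]
        linarith
      calc K * r j ≤ K * (r i / q) := by gcongr
        _ = K / q * r i := by ring
        _ ≤ γ / 2 * r i := by gcongr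
        _ = γ * r i / 2 := by ring
    intro i j hij
    rcases lt_or_gt_of_ne hij with h | h
    exacts [key i j h, (key j i h).symm]
  set B' : ℕ → Set X := fun j => {z | ∃ s, 0 < s ∧ s ≤ r j ∧
      ENNReal.ofReal (κ * s ^ D) ≤ μ.restrict (E j) (Metric.ball z (4 * s) ×ˢ univ)} with hB'
  -- Measurable hulls, of the same measure, so that the points can be counted by integration.
  set B : ℕ → Set X := fun j => toMeasurable ν (B' j) with hB
  have hνB : ∀ j, ν (B j) ≤ ENNReal.ofReal (c₂ * (6 * 4) ^ D / κ) * μ (E j) := by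
    intro j
    rw [hB]
    simp only
    rw [measure_toMeasurable]
    refine (measure_setOf_le_cylinder ν (μ.restrict (E j)) hc₂.le hκ0 (by norm_num) hν₂).trans ?_
    rw [Measure.restrict_apply_univ]
  set cnt : X → ℝ≥0∞ := fun z => ∑' j, (B j).indicator (fun _ => (1 : ℝ≥0∞)) z with hcnt
  have hcntm : Measurable cnt := by
    refine Measurable.tsum fun j => ?_
    exact measurable_const.indicator (measurableSet_toMeasurable _ _)
  -- Since the excursion sets are disjoint, the sum over all scales costs only one total mass of
  -- `μ`.
  have hcntint : ∫⁻ z, cnt z ∂ν ≤ ENNReal.ofReal (C₅ * ρ ^ D) := by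
    calc ∫⁻ z, cnt z ∂ν = ∑' j, ν (B j) := by
          rw [hcnt, lintegral_tsum fun j =>
            (measurable_const.indicator (measurableSet_toMeasurable _ _)).aemeasurable]
          congr 1
          ext j
          rw [lintegral_indicator (measurableSet_toMeasurable _ _)]
          simp [hB]
      _ ≤ ∑' j, ENNReal.ofReal (c₂ * (6 * 4) ^ D / κ) * μ (E j) :=
          ENNReal.tsum_le_tsum hνB
      _ = ENNReal.ofReal (c₂ * (6 * 4) ^ D / κ) * μ (⋃ j, E j) := by
          rw [ENNReal.tsum_mul_left, measure_iUnion hEdisj hEm]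
      _ ≤ ENNReal.ofReal (c₂ * (6 * 4) ^ D / κ) * ENNReal.ofReal (c₄ * ρ ^ D) := by
          gcongr
          exact (measure_mono (subset_univ _)).trans hμ
      _ = _ := by
          rw [← ENNReal.ofReal_mul (by positivity), hC₅]
          congr 1
          ring
  have hνcnt : ν {z | (N : ℝ≥0∞) ≤ cnt z} ≤ ENNReal.ofReal (a / 4) := by
    have h1 := (mul_meas_ge_le_lintegral (μ := ν) hcntm (N : ℝ≥0∞)).trans hcntint
    have hN' : ((N : ℕ) : ℝ≥0∞) = ENNReal.ofReal N := by simp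
    rw [hN'] at h1 ⊢
    rw [← ENNReal.mul_le_mul_iff_right (a := ENNReal.ofReal N) (by rw [Ne, ENNReal.ofReal_eq_zero, not_le]; exact hN0)
      ENNReal.ofReal_ne_top]
    refine h1.trans ?_
    rw [← ENNReal.ofReal_mul (by positivity)]
    refine ENNReal.ofReal_le_ofReal ?_
    rw [div_lt_iff₀ (by positivity)] at hN
    have h3 : N * (a / 4) = (N * (c₁ * (1 / 2) ^ D / 4)) * ρ ^ D := by rw [ha]; ring
    rw [h3]
    gcongr
  set G : Set X := (Metric.ball z₀ (ρ / 2) \ toMeasurable ν B₀) \ {z | (N : ℝ≥0∞) ≤ cnt z} with hG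
  have hGm : MeasurableSet G :=
    (Metric.isOpen_ball.measurableSet.diff (measurableSet_toMeasurable _ _)).diff
      (measurableSet_le measurable_const hcntm)
  have hGfin : ν G ≠ ⊤ := by
    refine ne_top_of_le_ne_top ENNReal.ofReal_ne_top
      ((measure_mono (t := Metric.ball z₀ (ρ / 2)) ?_).trans (hν₂ z₀ (ρ / 2) (by positivity)))
    exact fun z hz => hz.1.1
  have hGν : ENNReal.ofReal (a / 2) ≤ ν G := by
    have h1 : ENNReal.ofReal a ≤ ν (Metric.ball z₀ (ρ / 2)) := by
      refine le_trans (le_of_eq ?_) (hν₁ z₀ (ρ / 2) (by positivity))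
      rw [ha, mul_assoc, ← mul_pow]
      congr 3
      ring
    have h2 : ν (Metric.ball z₀ (ρ / 2)) ≤ ν G + ENNReal.ofReal (a / 2) := by
      calc ν (Metric.ball z₀ (ρ / 2)) ≤
            ν (G ∪ (toMeasurable ν B₀ ∪ {z | (N : ℝ≥0∞) ≤ cnt z})) := by
            refine measure_mono fun z hz => ?_
            by_cases h1 : z ∈ toMeasurable ν B₀
            · exact Or.inr (Or.inl h1)
            by_cases h2 : (N : ℝ≥0∞) ≤ cnt z
            · exact Or.inr (Or.inr h2)
            exact Or.inl ⟨⟨hz, h1⟩, h2⟩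
        _ ≤ ν G + (ν (toMeasurable ν B₀) + ν {z | (N : ℝ≥0∞) ≤ cnt z}) :=
            (measure_union_le _ _).trans (add_le_add le_rfl (measure_union_le _ _))
        _ ≤ ν G + (ENNReal.ofReal (a / 4) + ENNReal.ofReal (a / 4)) := by
            rw [measure_toMeasurable]
            gcongr
        _ = _ := by
            rw [← ENNReal.ofReal_add (by positivity) (by positivity)]
            congr 2
            ring
    have h3 := h1.trans h2
    have h4 : ENNReal.ofReal a = ENNReal.ofReal (a / 2) + ENNReal.ofReal (a / 2) := by
      rw [← ENNReal.ofReal_add (by positivity) (by positivity)]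
      congr 1
      ring
    rw [h4] at h3
    exact (ENNReal.add_le_add_iff_right ENNReal.ofReal_ne_top).mp h3
  -- The label at scale `j` is the height in units of `K * r j`, modulo `q + 1`.
  obtain ⟨F, hFG, -, hFν, hFl⟩ := exists_subset_label_eq ν hGm hGfin B
    (fun j z => ((⌊g z / (K * r j)⌋ : ℤ) : ZMod (q + 1)))
    (fun j => measurableSet_toMeasurable _ _)
    (fun j ω => by
      have h1 : Measurable fun z => ⌊g z / (K * r j)⌋ :=
        ((measurable_firstExit H.isOpen H.lt.le).div_const _).floor
      exact h1 (t := {n : ℤ | (n : ZMod (q + 1)) = ω}) (MeasurableSet.of_discrete)) N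
    (fun z hz => (not_le.mp hz.2).le)
  have hsub : ∀ z ∈ F, z ∈ Metric.ball z₀ (ρ / 2) := fun z hz => (hFG hz).1.1
  refine ⟨F, fun z hz => Metric.ball_subset_ball (by linarith) (hsub z hz), ?_, ?_⟩
  · have key : ∀ x ∈ F, ∀ y ∈ F, g x - g y ≤ K * q * dist x y := by
      intro x hx y hy
      by_contra! hcon
      have hKq : 0 < K * q := by positivity
      have hδ : 0 < g x - g y := lt_of_le_of_lt (by positivity) hcon
      have hxρ := Metric.ball_subset_ball (by linarith : ρ / 2 ≤ ρ) (hsub x hx)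
      have hyρ := Metric.ball_subset_ball (by linarith : ρ / 2 ≤ ρ) (hsub y hy)
      have hδ' : g x - g y < K * q * (ρ / 8) := by
        have h1 : g x ≤ h₂ := H.firstExit_le
        have h2 : h₁ + ρ < g y := H.add_lt_firstExit hyρ
        have h3 : (8 * A + 1) * (ρ / 8) ≤ q * (ρ / 8) := by gcongr
        have h4 : 1 * (q * (ρ / 8)) ≤ K * (q * (ρ / 8)) := by gcongr
        nlinarith
      -- At the scale matching the height difference, a slope above `K * q` forces the distance
      -- below `r j`. The pair is then steep, both points lie in `B j`, and their equal labels
      -- contradict `intCast_floor_ne`.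
      obtain ⟨j, hj1, hj2⟩ := exists_geometric_scale hq1 hδ hδ'
      have hdist : dist x y ≤ r j := by
        have h1 := hcon.trans hj2
        exact (lt_of_mul_lt_mul_left h1 hKq.le).le
      have hdens : μ (Metric.ball x (5 * r j) ×ˢ univ) <
          ENNReal.ofReal (m * c₃ * r j ^ D) := by
        by_contra! hc
        exact (hFG hx).1.2 (subset_toMeasurable _ _ ⟨r j, hr0 j, hrρ j, hc⟩)
      have hex := H.le_measure_excursion hγ₀ hγ₁ hc₀ hconn hν₁ (hsub x hx) (hsub y hy) (hr0 j)
        (hrρ j) hdens hdist hj1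
      have hxB : x ∈ B j :=
        subset_toMeasurable _ _ ⟨r j, hr0 j, le_rfl, hex x (Or.inl rfl)⟩
      have hyB : y ∈ B j :=
        subset_toMeasurable _ _ ⟨r j, hr0 j, le_rfl, hex y (Or.inr rfl)⟩
      have hKr : 0 < K * r j := by have := hr0 j; positivity
      refine intCast_floor_ne ?_ ?_ (hFl j x hx y hy hxB hyB)
      · rw [← sub_div, le_div_iff₀ hKr, one_mul]
        exact hj1
      · rw [← sub_div, div_lt_iff₀ hKr]
        calc g x - g y < K * q * (ρ / 8 / q ^ j) := hj2
          _ = q * (K * r j) := by rw [hr]; ring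
    refine LipschitzOnWith.of_dist_le_mul fun x hx y hy => ?_
    rw [Real.coe_toNNReal _ (by positivity), Real.dist_eq, abs_sub_le_iff]
    refine ⟨key x hx y hy, ?_⟩
    rw [dist_comm]
    exact key y hy x hx
  · have h1 := hGν.trans hFν
    rw [ZMod.card] at h1
    have h2 : (((q + 1 : ℕ) : ℝ≥0∞)) ^ N = ENNReal.ofReal ((q + 1 : ℝ) ^ N) := by
      rw [ENNReal.ofReal_pow (by positivity)]
      congr 1
      rw [show ((q : ℝ) + 1) = ((q + 1 : ℕ) : ℝ) by push_cast; rfl, ENNReal.ofReal_natCast]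
    rw [h2] at h1
    have hp : (0 : ℝ) < (q + 1 : ℝ) ^ N := by positivity
    rw [← ENNReal.mul_le_mul_iff_right (a := ENNReal.ofReal ((q + 1 : ℝ) ^ N)) (by simpa using hp)
      ENNReal.ofReal_ne_top]
    refine le_trans (le_of_eq ?_) h1
    rw [← ENNReal.ofReal_mul hp.le, ha]
    congr 1
    field_simp

/-! ### Lebesgue measure, balls and cubes for the parabolic distance -/

namespace SpaceTime

/-- The identity map between `ℝⁿ × ℝ` and space-time. -/
def homeo (n : ℕ) : (EuclideanSpace ℝ (Fin n) × ℝ) ≃ₜ SpaceTime n where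
  toFun p := p
  invFun p := p
  continuous_toFun := continuous_id (X := EuclideanSpace ℝ (Fin n) × ℝ)
  continuous_invFun := continuous_id (X := EuclideanSpace ℝ (Fin n) × ℝ)

instance (n : ℕ) : SecondCountableTopology (SpaceTime n) :=
  (homeo n).symm.secondCountableTopology

instance (n : ℕ) : LocallyConnectedSpace (SpaceTime n) :=
  inferInstanceAs (LocallyConnectedSpace (EuclideanSpace ℝ (Fin n) × ℝ))

theorem continuous_fst' (n : ℕ) :
    Continuous fun p : SpaceTime n => (p.1 : EuclideanSpace ℝ (Fin n)) :=
  continuous_fst.comp (homeo n).symm.continuous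

theorem continuous_snd' (n : ℕ) : Continuous fun p : SpaceTime n => (p.2 : ℝ) :=
  continuous_snd.comp (homeo n).symm.continuous

/-- Lebesgue measure on space-time. -/
noncomputable def lebesgue (n : ℕ) : Measure (SpaceTime n) := volume.map (homeo n)

theorem lebesgue_apply {n : ℕ} (s : Set (SpaceTime n)) :
    lebesgue n s = volume (homeo n ⁻¹' s) :=
  (homeo n).toMeasurableEquiv.map_apply s

theorem mem_ball_iff {n : ℕ} {p q : SpaceTime n} {r : ℝ} :
    q ∈ Metric.ball p r ↔ ‖q.1 - p.1‖ + Real.sqrt |q.2 - p.2| < r := Iff.rfl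

/-- A parabolic ball lies between two products of a Euclidean ball of radius about `r` and a time
interval of length about `r ^ 2`; hence the homogeneous dimension `n + 2`. -/
theorem exists_lebesgue_ball_bounds (n : ℕ) : ∃ c₁ c₂ : ℝ, 0 < c₁ ∧ 0 < c₂ ∧
    (∀ (p : SpaceTime n) (r : ℝ), 0 < r →
      ENNReal.ofReal (c₁ * r ^ (n + 2)) ≤ lebesgue n (Metric.ball p r)) ∧
    ∀ (p : SpaceTime n) (r : ℝ), 0 < r →
      lebesgue n (Metric.ball p r) ≤ ENNReal.ofReal (c₂ * r ^ (n + 2)) := by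
  set ω : ℝ := (volume (Metric.ball (0 : EuclideanSpace ℝ (Fin n)) 1)).toReal with hω
  have hωfin : volume (Metric.ball (0 : EuclideanSpace ℝ (Fin n)) 1) ≠ ⊤ :=
    measure_ball_lt_top.ne
  have hω0 : 0 < ω := ENNReal.toReal_pos (Metric.measure_ball_pos _ _ one_pos).ne' hωfin
  have hprod : ∀ (p : SpaceTime n) (a b : ℝ), 0 < a → 0 < b →
      volume (Metric.ball p.1 a ×ˢ Metric.ball p.2 b) = ENNReal.ofReal (ω * a ^ n * (2 * b)) := by
    intro p a b ha hb
    rw [Measure.volume_eq_prod, Measure.prod_prod, Measure.addHaar_ball_of_pos _ _ ha,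
      Real.volume_ball, finrank_euclideanSpace_fin, ← ENNReal.ofReal_toReal hωfin, ← hω,
      ← ENNReal.ofReal_mul (by positivity), ← ENNReal.ofReal_mul (by positivity)]
    congr 1
    ring
  refine ⟨ω * (1 / 2) ^ n * (1 / 2), ω * 2, by positivity, by positivity, ?_, ?_⟩
  · intro p r hr
    rw [lebesgue_apply]
    have h1 := hprod p (r / 2) (r ^ 2 / 4) (by positivity) (by positivity)
    calc ENNReal.ofReal (ω * (1 / 2) ^ n * (1 / 2) * r ^ (n + 2))
        = volume (Metric.ball p.1 (r / 2) ×ˢ Metric.ball p.2 (r ^ 2 / 4)) := by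
          rw [h1]
          congr 1
          rw [div_eq_mul_one_div r 2, mul_pow]
          ring
      _ ≤ _ := by
          refine measure_mono ?_
          rintro ⟨X, t⟩ ⟨hX, ht⟩
          rw [mem_preimage, mem_ball_iff]
          have h2 : ‖X - p.1‖ < r / 2 := by rw [← dist_eq_norm]; exact hX
          have h3 : Real.sqrt |t - p.2| < r / 2 := by
            rw [Real.sqrt_lt' (by positivity)]
            have h4 : |t - p.2| < r ^ 2 / 4 := by rw [← Real.dist_eq]; exact ht
            linarith [h4, (by ring : (r / 2) ^ 2 = r ^ 2 / 4)]
          have : ‖X - p.1‖ + Real.sqrt |t - p.2| < r := by linarith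
          exact this
  · intro p r hr
    rw [lebesgue_apply]
    have h1 := hprod p r (r ^ 2) hr (by positivity)
    calc volume (homeo n ⁻¹' Metric.ball p r)
        ≤ volume (Metric.ball p.1 r ×ˢ Metric.ball p.2 (r ^ 2)) := by
          refine measure_mono ?_
          rintro ⟨X, t⟩ hq
          have h2 : ‖X - p.1‖ + Real.sqrt |t - p.2| < r := hq
          have h3 := norm_nonneg (X - p.1)
          have h4 := Real.sqrt_nonneg |t - p.2|
          refine ⟨?_, ?_⟩
          · rw [Metric.mem_ball, dist_eq_norm]; simp only; linarith
          · rw [Metric.mem_ball, Real.dist_eq]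
            exact (Real.sqrt_lt' hr).mp (by linarith)
      _ = _ := by
          rw [h1]
          congr 1
          ring

/-- Although the distance is not a norm, straight segments to the centre stay in the ball, since
both terms of the distance decrease along them. -/
theorem isPreconnected_ball {n : ℕ} (p : SpaceTime n) (r : ℝ) :
    IsPreconnected (Metric.ball p r) := by
  refine isPreconnected_of_forall p fun q hq => ?_
  let f : ℝ → SpaceTime n := fun s => (p.1 + s • (q.1 - p.1), p.2 + s * (q.2 - p.2))
  have hf : Continuous f := by
    refine (homeo n).continuous.comp (f := fun s : ℝ =>
      ((p.1 + s • (q.1 - p.1) : EuclideanSpace ℝ (Fin n)), p.2 + s * (q.2 - p.2))) ?_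
    fun_prop
  refine ⟨f '' Icc 0 1, ?_, ⟨0, by simp, ?_⟩, ⟨1, by simp, ?_⟩,
    isPreconnected_Icc.image _ hf.continuousOn⟩
  · rintro _ ⟨s, hs, rfl⟩
    rw [mem_ball_iff] at hq ⊢
    refine lt_of_le_of_lt ?_ hq
    simp only [f, add_sub_cancel_left]
    have h1 : ‖s • (q.1 - p.1)‖ ≤ ‖q.1 - p.1‖ := by
      rw [norm_smul, Real.norm_of_nonneg hs.1]
      exact mul_le_of_le_one_left (norm_nonneg _) hs.2
    have h2 : |s * (q.2 - p.2)| ≤ |q.2 - p.2| := by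
      rw [abs_mul, abs_of_nonneg hs.1]
      exact mul_le_of_le_one_left (abs_nonneg _) hs.2
    exact add_le_add h1 (Real.sqrt_le_sqrt h2)
  · simp only [f, zero_smul, add_zero, zero_mul]; rfl
  · simp only [f, one_smul, one_mul, add_sub_cancel]; rfl

theorem norm_le_of_abs_le {n : ℕ} {X : EuclideanSpace ℝ (Fin n)} {r : ℝ}
    (h : ∀ i, |X i| ≤ r) : ‖X‖ ≤ n * r := by
  rcases n with _ | n
  · simp [Subsingleton.elim X 0]
  have hr : 0 ≤ r := (abs_nonneg _).trans (h 0)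
  refine abs_le_of_sq_le_sq' ?_ (by positivity) |>.2
  rw [EuclideanSpace.norm_sq_eq]
  calc ∑ i, ‖X i‖ ^ 2 ≤ ∑ _i : Fin (n + 1), r ^ 2 :=
        Finset.sum_le_sum fun i _ => pow_le_pow_left₀ (norm_nonneg _) (h i) 2
    _ = (n + 1 : ℝ) * r ^ 2 := by simp
    _ ≤ ((n + 1 : ℕ) * r) ^ 2 := by
        push_cast
        nlinarith [mul_nonneg (Nat.cast_nonneg (α := ℝ) n) (sq_nonneg r),
          mul_nonneg (sq_nonneg (n : ℝ)) (sq_nonneg r)]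

theorem abs_le_norm {n : ℕ} (X : EuclideanSpace ℝ (Fin n)) (i : Fin n) : |X i| ≤ ‖X‖ :=
  PiLp.norm_apply_le X i

theorem dist_le_of_mem_cube {n : ℕ} {p q : SpaceTime n} {r : ℝ} (hr : 0 < r)
    (hq : q ∈ cube p r) : dist q p ≤ (n + 1) * r := by
  rw [dist_def]
  have h1 : ‖q.1 - p.1‖ ≤ n * r := norm_le_of_abs_le fun i => (hq.1 i).le
  have h2 : Real.sqrt |q.2 - p.2| ≤ r := Real.sqrt_le_iff.mpr ⟨hr.le, hq.2.le⟩
  linarith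

theorem ediam_cube_le {n : ℕ} (p : SpaceTime n) {r : ℝ} (hr : 0 < r) :
    Metric.ediam (cube p r) ≤ ENNReal.ofReal (2 * (n + 1) * r) := by
  refine Metric.ediam_le fun x hx y hy => ?_
  rw [edist_dist]
  refine ENNReal.ofReal_le_ofReal ?_
  have h1 := dist_le_of_mem_cube hr hx
  have h2 := dist_le_of_mem_cube hr hy
  linarith [dist_triangle_right x y p]

theorem mem_cube_self {n : ℕ} (p : SpaceTime n) {r : ℝ} (hr : 0 < r) : p ∈ cube p r :=
  ⟨fun i => by simpa using hr, by simpa using by positivity⟩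

theorem ediam_cube_pos {n : ℕ} (p : SpaceTime n) {r : ℝ} (hr : 0 < r) :
    0 < Metric.ediam (cube p r) := by
  rw [Metric.ediam_pos_iff]
  refine ⟨p, mem_cube_self p hr, (p.1, p.2 + r ^ 2 / 2), ⟨fun i => by simpa using hr, ?_⟩, ?_⟩
  · simp only [add_sub_cancel_left]
    rw [abs_of_pos (by positivity)]
    linarith [pow_pos hr 2]
  · intro h
    have h1 : p.2 = p.2 + r ^ 2 / 2 := congrArg Prod.snd h
    linarith [pow_pos hr 2]

/-! ### Parabolic Hausdorff measure and the initial and final times -/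

/-- Projections do not increase parabolic Hausdorff measure by more than a constant factor. -/
theorem measure_image_le_parHausdorff {n D : ℕ} {X : Type*} [MetricSpace X] [MeasurableSpace X]
    {ν : Measure X} {c : ℝ} (hc : 0 < c)
    (hν : ∀ x r, 0 < r → ν (Metric.ball x r) ≤ ENNReal.ofReal (c * r ^ D))
    {f : SpaceTime n → X} (hf : LipschitzWith 1 f) (A : Set (SpaceTime n)) :
    ν (f '' A) ≤ ENNReal.ofReal (c * 2 ^ D) * parHausdorff n D A := by
  classical
  set C : ℝ := c * 2 ^ D with hC
  have hC0 : 0 < C := by positivity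
  set m : Set (SpaceTime n) → ℝ≥0∞ := fun s => if IsCube s then Metric.ediam s ^ (D : ℝ) else ⊤
    with hm
  have hle : ∀ s, ν (f '' s) ≤ ENNReal.ofReal C * m s := by
    intro s
    by_cases hs : IsCube s
    · obtain ⟨p, r, hr, rfl⟩ := hs
      have hfin : Metric.ediam (cube p r) ≠ ⊤ :=
        ne_top_of_le_ne_top ENNReal.ofReal_ne_top (ediam_cube_le p hr)
      set δ := (Metric.ediam (cube p r)).toReal with hδ
      have hδ0 : 0 < δ := ENNReal.toReal_pos (ediam_cube_pos p hr).ne' hfin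
      have hδe : Metric.ediam (cube p r) = ENNReal.ofReal δ := (ENNReal.ofReal_toReal hfin).symm
      have hsub : f '' cube p r ⊆ Metric.ball (f p) (2 * δ) := by
        rintro _ ⟨q, hq, rfl⟩
        have h1 := Metric.edist_le_ediam_of_mem hq (mem_cube_self p hr)
        rw [hδe, edist_dist, ENNReal.ofReal_le_ofReal_iff hδ0.le] at h1
        have h2 := hf.dist_le_mul q p
        rw [NNReal.coe_one, one_mul] at h2
        exact Metric.mem_ball.mpr (by linarith)
      refine (measure_mono hsub).trans ((hν _ _ (by positivity)).trans (le_of_eq ?_))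
      rw [hm]
      simp only
      rw [if_pos ⟨p, r, hr, rfl⟩, hδe, ENNReal.rpow_natCast, ← ENNReal.ofReal_pow hδ0.le,
        ← ENNReal.ofReal_mul hC0.le, hC]
      congr 1
      ring
    · rw [hm]
      simp only
      rw [if_neg hs, ENNReal.mul_top (by simpa using hC0)]
      exact le_top
  have hCne : ENNReal.ofReal C ≠ 0 := by simpa using hC0
  -- The covering outer measure at scale 1 is the largest one bounded by `m` on sets of diameter at
  -- most 1, so the estimate `hle` for single sets suffices.
  have h1 : (ENNReal.ofReal C)⁻¹ • OuterMeasure.comap f ν.toOuterMeasure ≤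
      OuterMeasure.mkMetric' m := by
    refine le_trans (b := OuterMeasure.mkMetric'.pre m 1) ?_ ?_
    · rw [OuterMeasure.mkMetric'.le_pre]
      intro s _
      rw [smul_apply, OuterMeasure.comap_apply, smul_eq_mul]
      rw [mul_comm, ← div_eq_mul_inv]
      exact ENNReal.div_le_of_le_mul' (hle s)
    · exact le_iSup₂_of_le (f := fun (r : ℝ≥0∞) (_ : r > 0) => OuterMeasure.mkMetric'.pre m r)
        1 one_pos le_rfl
  have h2 : (ENNReal.ofReal C)⁻¹ * ν (f '' A) ≤ parHausdorff n D A := by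
    refine (h1 A).trans ?_
    have h3 := OuterMeasure.le_trim (OuterMeasure.mkMetric' m) A
    rw [← Measure.mkMetric'_toOuterMeasure] at h3
    exact h3
  calc ν (f '' A) = ENNReal.ofReal C * ((ENNReal.ofReal C)⁻¹ * ν (f '' A)) := by
        rw [← mul_assoc, ENNReal.mul_inv_cancel hCne ENNReal.ofReal_ne_top, one_mul]
    _ ≤ _ := by gcongr

/-- Centres of a grid of `Nⁿ` cubes of half side `R / N` covering the cube of half side `R`. -/
theorem exists_grid {n : ℕ} (X : EuclideanSpace ℝ (Fin n)) {R : ℝ} (hR : 0 < R) {N : ℕ}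
    (hN : 0 < N) : ∃ c : (Fin n → Fin N) → EuclideanSpace ℝ (Fin n),
      ∀ Y : EuclideanSpace ℝ (Fin n), (∀ i, |Y i - X i| < R) → ∃ k, ∀ i, |Y i - c k i| ≤ R / N := by
  have hN' : (0 : ℝ) < N := by exact_mod_cast hN
  refine ⟨fun k => WithLp.toLp 2 fun i => X i - R + (2 * (k i : ℕ) + 1) * (R / N), fun Y hY => ?_⟩
  have hpos : ∀ i, 0 ≤ (Y i - X i + R) * N / (2 * R) := fun i => by
    have := (abs_lt.mp (hY i)).1
    have : 0 ≤ Y i - X i + R := by linarith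
    positivity
  have hlt : ∀ i, ⌊(Y i - X i + R) * N / (2 * R)⌋₊ < N := fun i => by
    rw [Nat.floor_lt (hpos i), div_lt_iff₀ (by positivity)]
    have := (abs_lt.mp (hY i)).2
    nlinarith
  refine ⟨fun i => ⟨_, hlt i⟩, fun i => ?_⟩
  have h1 := Nat.floor_le (hpos i)
  have h2 := Nat.lt_floor_add_one ((Y i - X i + R) * N / (2 * R))
  set a : ℝ := ((⌊(Y i - X i + R) * N / (2 * R)⌋₊ : ℕ) : ℝ)
  rw [le_div_iff₀ (by positivity)] at h1
  rw [div_lt_iff₀ (by positivity)] at h2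
  have e1 : Y i - (X i - R + (2 * a + 1) * (R / N)) =
      ((Y i - X i + R) * N - a * (2 * R) - R) / N := by
    field_simp
    ring
  change |Y i - (X i - R + (2 * a + 1) * (R / N))| ≤ R / N
  rw [e1, abs_div, abs_of_pos hN']
  gcongr
  rw [abs_le]
  constructor <;> linarith

/-- A bounded slice is covered by `N ^ n` cubes of diameter of order `1 / N`, at a total cost of
order `N ^ n * N ^ (-(n + 1)) = 1 / N`. -/
theorem parHausdorff_bounded_slice {n : ℕ} (X : EuclideanSpace ℝ (Fin n)) {R : ℝ} (hR : 0 < R)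
    (T : ℝ) : parHausdorff n ((n : ℝ) + 1)
      {q | q.2 = T ∧ ∀ i, |q.1 i - X i| < R} = 0 := by
  classical
  set Z : Set (SpaceTime n) := {q | q.2 = T ∧ ∀ i, |q.1 i - X i| < R} with hZ
  have hZm : MeasurableSet Z := by
    have h1 : IsClosed {q : SpaceTime n | q.2 = T} :=
      isClosed_eq (continuous_snd' n) continuous_const
    have h2 : IsOpen {q : SpaceTime n | ∀ i, |q.1 i - X i| < R} := by
      simp only [ofPred_forall]
      refine isOpen_iInter_of_finite fun i => isOpen_lt ?_ continuous_const
      have h3 := continuous_fst' n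
      fun_prop
    exact h1.measurableSet.inter h2.measurableSet
  set m : Set (SpaceTime n) → ℝ≥0∞ :=
    fun s => if IsCube s then Metric.ediam s ^ ((n : ℝ) + 1) else ⊤ with hm
  have h0 : parHausdorff n ((n : ℝ) + 1) Z = OuterMeasure.mkMetric' m Z := by
    have h1 := OuterMeasure.trim_eq (OuterMeasure.mkMetric' m) hZm
    rw [← Measure.mkMetric'_toOuterMeasure] at h1
    exact h1
  rw [h0]
  unfold OuterMeasure.mkMetric'
  simp only [OuterMeasure.iSup_apply, ENNReal.iSup_eq_zero]
  intro δ hδ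
  set C : ℝ := 2 * (n + 1) * (2 * R) with hC
  have hbound : ∀ N : ℕ, 0 < N → ENNReal.ofReal (C / N) ≤ δ →
      OuterMeasure.mkMetric'.pre m δ Z ≤ ENNReal.ofReal (C ^ (n + 1) / N) := by
    intro N hN hNδ
    have hN' : (0 : ℝ) < N := by exact_mod_cast hN
    obtain ⟨c, hc⟩ := exists_grid X hR hN
    have hdiam : ∀ k, Metric.ediam (cube ((c k, T) : SpaceTime n) (2 * R / N)) ≤
        ENNReal.ofReal (C / N) := fun k =>
      (ediam_cube_le _ (by positivity)).trans_eq (by rw [hC]; congr 1; ring)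
    have hsub : Z ⊆ ⋃ k, cube ((c k, T) : SpaceTime n) (2 * R / N) := by
      rintro ⟨Y, t⟩ ⟨ht, hY⟩
      obtain ⟨k, hk⟩ := hc Y hY
      have h2 : R / N < 2 * R / N := by gcongr; linarith
      refine mem_iUnion.mpr ⟨k, fun i => (hk i).trans_lt h2, ?_⟩
      have h3 : t = T := ht
      simp only [h3, sub_self, abs_zero]
      positivity
    calc OuterMeasure.mkMetric'.pre m δ Z
        ≤ OuterMeasure.mkMetric'.pre m δ (⋃ k, cube ((c k, T) : SpaceTime n) (2 * R / N)) :=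
          measure_mono hsub
      _ ≤ ∑ k, OuterMeasure.mkMetric'.pre m δ (cube ((c k, T) : SpaceTime n) (2 * R / N)) :=
          measure_iUnion_fintype_le _ _
      _ ≤ ∑ _k : Fin n → Fin N, ENNReal.ofReal ((C / N) ^ (n + 1)) := by
          refine Finset.sum_le_sum fun k _ => ?_
          refine (OuterMeasure.mkMetric'.pre_le ((hdiam k).trans hNδ)).trans ?_
          rw [hm]
          simp only
          rw [if_pos ⟨_, _, by positivity, rfl⟩, ENNReal.ofReal_pow (by positivity),
            ← ENNReal.rpow_natCast]
          push_cast
          exact ENNReal.rpow_le_rpow (hdiam k) (by positivity)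
      _ = ENNReal.ofReal (C ^ (n + 1) / N) := by
          rw [Finset.sum_const, Finset.card_univ, nsmul_eq_mul]
          simp only [Fintype.card_pi, Fintype.card_fin, Finset.prod_const, Finset.card_univ]
          rw [← ENNReal.ofReal_natCast, ← ENNReal.ofReal_mul (by positivity)]
          congr 1
          push_cast
          rw [div_pow]
          field_simp
          ring
  have hto : ∀ a : ℝ, Filter.Tendsto (fun N : ℕ => ENNReal.ofReal (a / N)) Filter.atTop
      (nhds 0) := fun a => by
    have h1 := ENNReal.tendsto_ofReal (tendsto_const_div_atTop_nhds_zero_nat a)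
    rwa [ENNReal.ofReal_zero] at h1
  refine le_antisymm (ge_of_tendsto (hto (C ^ (n + 1))) ?_) zero_le
  filter_upwards [Filter.eventually_gt_atTop 0, (hto C).eventually_le_const hδ] with N h1 h2
  exact hbound N h1 h2

/-- Time slices are null sets for parabolic Hausdorff measure of dimension `n + 1`. -/
theorem parHausdorff_slice {n : ℕ} (T : ℝ) :
    parHausdorff n ((n : ℝ) + 1) {q | q.2 = T} = 0 := by
  have hsub : {q : SpaceTime n | q.2 = T} ⊆
      ⋃ N : ℕ, {q | q.2 = T ∧ ∀ i, |q.1 i - (0 : EuclideanSpace ℝ (Fin n)) i| < N + 1} := by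
    intro q hq
    obtain ⟨N, hN⟩ := exists_nat_gt ‖q.1‖
    refine mem_iUnion.mpr ⟨N, hq, fun i => ?_⟩
    have := abs_le_norm q.1 i
    simp only [PiLp.zero_apply, sub_zero]
    linarith
  refine measure_mono_null hsub (measure_iUnion_null fun N => ?_)
  exact parHausdorff_bounded_slice 0 (by positivity) T

end SpaceTime

namespace SpaceTime

theorem parHausdorff_diff_timeStrip {n : ℕ} (S : Set (SpaceTime n)) :
    parHausdorff n ((n : ℝ) + 1) (S \ timeStrip S) = 0 := by
  -- For an infinite initial or final time `toReal` is 0 and the corresponding slice is superfluous;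
  -- it is a null set anyway.
  have hsub : S \ timeStrip S ⊆
      {q | q.2 = (initialTime S).toReal} ∪ {q | q.2 = (finalTime S).toReal} := by
    rintro q ⟨hqS, hq⟩
    have h1 : initialTime S ≤ ((q.2 : ℝ) : EReal) := iInf₂_le q hqS
    have h2 : ((q.2 : ℝ) : EReal) ≤ finalTime S :=
      le_iSup₂ (f := fun (p : SpaceTime n) (_ : p ∈ S) => ((p.2 : ℝ) : EReal)) q hqS
    rcases h1.eq_or_lt with h | h
    · left
      change q.2 = _
      rw [h, EReal.toReal_coe]
    rcases h2.eq_or_lt with h' | h'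
    · right
      change q.2 = _
      rw [← h', EReal.toReal_coe]
    exact absurd ⟨h, h'⟩ hq
  exact measure_mono_null hsub (measure_union_null (parHausdorff_slice _) (parHausdorff_slice _))

theorem surfaceMeasure_surfaceCube {n : ℕ} {S : Set (SpaceTime n)} (hS : IsClosed S)
    (p : SpaceTime n) (r : ℝ) :
    surfaceMeasure S (surfaceCube S p r) = parHausdorff n ((n : ℝ) + 1) (S ∩ cube p r) := by
  rw [surfaceMeasure, Measure.restrict_apply' hS.measurableSet, surfaceCube, inter_comm,
    ← inter_assoc, inter_self]

theorem Admissible.of_le {n : ℕ} {S : Set (SpaceTime n)} {p q : SpaceTime n} {R r : ℝ}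
    (h : Admissible S p R) (hq : q ∈ S) (hqt : q ∈ timeStrip S) (hr : 0 < r) (hrR : r ≤ R) :
    Admissible S q r :=
  ⟨hq, hqt, hr, (ENNReal.ofReal_le_ofReal hrR).trans_lt h.2.2.2⟩

/-- A regular surface has little mass in thin time slabs. -/
theorem parHausdorff_slab_le {n : ℕ} {S : Set (SpaceTime n)} {M : ℝ}
    (hS : IsClosed S) (hADR : IsParabolicADR S M) {p : SpaceTime n} {R : ℝ}
    (hp : Admissible S p R) {N : ℕ} (hN : 2 ≤ N) {W : Set (SpaceTime n)}
    (hW : W ⊆ S ∩ cube p (R / 2)) (hWt : ∀ s ∈ W, ∀ s' ∈ W, |s.2 - s'.2| ≤ (R / N) ^ 2) :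
    parHausdorff n ((n : ℝ) + 1) W ≤ ENNReal.ofReal (M * (2 * R) ^ (n + 1) / N) := by
  have hR := hp.2.2.1
  have hN' : (2 : ℝ) ≤ N := by exact_mod_cast hN
  have hN0 : (0 : ℝ) < N := by linarith
  obtain ⟨c, hc⟩ := exists_grid p.1 (R := R / 2) (by positivity) (N := N) (by omega)
  -- Each of `N ^ n` spatial cells, over the thin slab, fits into a surface cube of length `2 R / N`
  -- about any of its points. Regularity bounds each by `M (2 R / N) ^ (n + 1)`, which leaves a
  -- factor `1 / N`. Points outside the strip are null, and the others are admissible centres.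
  set C : (Fin n → Fin N) → Set (SpaceTime n) :=
    fun k => {q | q ∈ W ∧ q ∈ timeStrip S ∧ ∀ i, |q.1 i - c k i| ≤ R / 2 / N} with hC
  have hCν : ∀ k, parHausdorff n ((n : ℝ) + 1) (C k) ≤
      ENNReal.ofReal (M * (2 * R / N) ^ (n + 1)) := by
    intro k
    rcases (C k).eq_empty_or_nonempty with h0 | ⟨s, hsW, hst, hsc⟩
    · rw [h0, measure_empty]; exact zero_le
    · have hadm : Admissible S s (2 * R / N) := by
        refine hp.of_le (hW hsW).1 hst (by positivity) ?_
        rw [div_le_iff₀ hN0]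
        nlinarith
      have h1 := (hADR s _ hadm).2
      rw [surfaceMeasure_surfaceCube hS] at h1
      refine le_trans (measure_mono ?_) h1
      rintro q ⟨hqW, hqt, hqc⟩
      refine ⟨(hW hqW).1, fun i => ?_, ?_⟩
      · have h2 := abs_sub_le (q.1 i) (c k i) (s.1 i)
        have h3 := hqc i
        have h4 := hsc i
        rw [abs_sub_comm] at h4
        have h5 : R / 2 / N + R / 2 / N < 2 * R / N := by
          rw [← add_div]
          gcongr
          linarith
        linarith
      · refine (hWt q hqW s hsW).trans_lt ?_
        gcongr
        linarith
  have hsub : W ⊆ (⋃ k, C k) ∪ (S \ timeStrip S) := by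
    intro q hq
    by_cases hqt : q ∈ timeStrip S
    · obtain ⟨k, hk⟩ := hc q.1 (hW hq).2.1
      exact Or.inl (mem_iUnion.mpr ⟨k, hq, hqt, hk⟩)
    · exact Or.inr ⟨(hW hq).1, hqt⟩
  calc parHausdorff n ((n : ℝ) + 1) W
      ≤ parHausdorff n ((n : ℝ) + 1) (⋃ k, C k) + parHausdorff n ((n : ℝ) + 1) (S \ timeStrip S) :=
        (measure_mono hsub).trans (measure_union_le _ _)
    _ = parHausdorff n ((n : ℝ) + 1) (⋃ k, C k) := by rw [parHausdorff_diff_timeStrip, add_zero]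
    _ ≤ ∑ k, parHausdorff n ((n : ℝ) + 1) (C k) := measure_iUnion_fintype_le _ _
    _ ≤ ∑ _k : Fin n → Fin N, ENNReal.ofReal (M * (2 * R / N) ^ (n + 1)) :=
        Finset.sum_le_sum fun k _ => hCν k
    _ = _ := by
        rw [Finset.sum_const, Finset.card_univ, nsmul_eq_mul]
        simp only [Fintype.card_pi, Fintype.card_fin, Finset.prod_const, Finset.card_univ]
        rw [← ENNReal.ofReal_natCast, ← ENNReal.ofReal_mul (by positivity)]
        congr 1
        push_cast
        rw [div_pow]
        field_simp
        ring

/-- Near every admissible point there is a surface point whose time is at a definite distance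
from the initial and the final time. -/
theorem exists_interior_time (n : ℕ) {M : ℝ} (hM : 1 ≤ M) :
    ∃ N : ℕ, 2 ≤ N ∧ ∀ S : Set (SpaceTime n), IsClosed S → IsParabolicADR S M →
      ∀ p R, Admissible S p R → ∃ s ∈ S, s ∈ cube p (R / 2) ∧
        initialTime S < ((s.2 - (R / N) ^ 2 : ℝ) : EReal) ∧
        ((s.2 + (R / N) ^ 2 : ℝ) : EReal) < finalTime S := by
  -- If every surface point were close to an end time, two thin slabs would carry the whole surface
  -- cube. Their mass is the fraction `2 ^ (2 n + 3) M ^ 2 / N` of the regular lower bound, so this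
  -- `N` gives a contradiction.
  obtain ⟨N, hN⟩ := exists_nat_gt (max 2 (2 ^ (2 * n + 3) * M ^ 2))
  have hN2 : (2 : ℝ) < N := (le_max_left _ _).trans_lt hN
  have hNM : 2 ^ (2 * n + 3) * M ^ 2 < N := (le_max_right _ _).trans_lt hN
  have hN2' : 2 ≤ N := by exact_mod_cast hN2.le
  refine ⟨N, hN2', fun S hS hADR p R hp => ?_⟩
  have hR := hp.2.2.1
  by_contra! hcon
  set δ := (R / N) ^ 2 with hδ
  set W₀ := {s | s ∈ S ∩ cube p (R / 2) ∧ ((s.2 - δ : ℝ) : EReal) ≤ initialTime S} with hW₀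
  set W₁ := {s | s ∈ S ∩ cube p (R / 2) ∧ finalTime S ≤ ((s.2 + δ : ℝ) : EReal)} with hW₁
  have hsub : S ∩ cube p (R / 2) ⊆ W₀ ∪ W₁ := by
    intro s hs
    by_cases h : initialTime S < ((s.2 - δ : ℝ) : EReal)
    · exact Or.inr ⟨hs, hcon s hs.1 hs.2 h⟩
    · exact Or.inl ⟨hs, not_lt.mp h⟩
  have hinit : ∀ s ∈ S, initialTime S ≤ ((s.2 : ℝ) : EReal) := fun s hs => iInf₂_le s hs
  have hfin : ∀ s ∈ S, ((s.2 : ℝ) : EReal) ≤ finalTime S := fun s hs =>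
    le_iSup₂ (f := fun (p : SpaceTime n) (_ : p ∈ S) => ((p.2 : ℝ) : EReal)) s hs
  have h₀ := parHausdorff_slab_le hS hADR hp hN2' (W := W₀) (fun s hs => hs.1)
    (fun s hs s' hs' => by
      have h1 := EReal.coe_le_coe_iff.mp (hs.2.trans (hinit s' hs'.1.1))
      have h2 := EReal.coe_le_coe_iff.mp (hs'.2.trans (hinit s hs.1.1))
      rw [abs_le]; constructor <;> linarith)
  have h₁ := parHausdorff_slab_le hS hADR hp hN2' (W := W₁) (fun s hs => hs.1)
    (fun s hs s' hs' => by
      have h1 := EReal.coe_le_coe_iff.mp ((hfin s' hs'.1.1).trans hs.2)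
      have h2 := EReal.coe_le_coe_iff.mp ((hfin s hs.1.1).trans hs'.2)
      rw [abs_le]; constructor <;> linarith)
  have h2 := (hADR p (R / 2)
    (hp.of_le hp.1 hp.2.1 (by positivity) (by linarith))).1
  rw [surfaceMeasure_surfaceCube hS] at h2
  have h3 := ((h2.trans (measure_mono hsub)).trans (measure_union_le _ _)).trans (add_le_add h₀ h₁)
  rw [← ENNReal.ofReal_add (by positivity) (by positivity),
    ENNReal.ofReal_le_ofReal_iff (by positivity)] at h3
  have e1 : M * (2 * R) ^ (n + 1) / N + M * (2 * R) ^ (n + 1) / N =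
      (2 ^ (2 * n + 3) * M ^ 2) / N * (M⁻¹ * (R / 2) ^ (n + 1)) := by
    rw [mul_pow, div_pow]
    field_simp
    ring
  rw [e1] at h3
  have h4 : 0 < M⁻¹ * (R / 2) ^ (n + 1) := by positivity
  have h5 : (2 ^ (2 * n + 3) * M ^ 2) / N < 1 := by
    rw [div_lt_one (by linarith)]; exact hNM
  nlinarith

/-! ### Rotated coordinates -/

/-- Rotated coordinates `(x, t)` and `xₙ`, as a map into base times height. -/
noncomputable def chart {d : ℕ} (T : EuclideanSpace ℝ (Fin (d + 1)) ≃ₗᵢ[ℝ] EuclideanSpace ℝ (Fin (d + 1))) :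
    SpaceTime (d + 1) ≃ₜ SpaceTime d × ℝ where
  toFun q := (homeo d (proj (spaceMap T q)), T q.1 (Fin.last d))
  invFun y := homeo (d + 1)
    (T.symm (WithLp.toLp 2 (Fin.snoc (α := fun _ => ℝ) (fun i => y.1.1 i) y.2)), y.1.2)
  left_inv q := by
    refine Prod.ext ?_ rfl
    change T.symm _ = q.1
    rw [LinearIsometryEquiv.symm_apply_eq]
    ext i
    refine Fin.lastCases ?_ (fun j => ?_) i
    · simp only [Fin.snoc_last]
    · simp only [Fin.snoc_castSucc]
      rfl
  right_inv y := by
    refine Prod.ext (Prod.ext ?_ rfl) ?_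
    · ext i
      change T (T.symm _) i.castSucc = y.1.1 i
      rw [LinearIsometryEquiv.apply_symm_apply]
      simp only [Fin.snoc_castSucc]
    · change T (T.symm _) (Fin.last d) = y.2
      rw [LinearIsometryEquiv.apply_symm_apply]
      simp only [Fin.snoc_last]
  continuous_toFun := by
    have h1 := continuous_fst' (d + 1)
    have h2 := continuous_snd' (d + 1)
    refine Continuous.prodMk ((homeo d).continuous.comp ?_) ?_
    · unfold proj spaceMap
      fun_prop
    · fun_prop
  continuous_invFun := by
    refine (homeo (d + 1)).continuous.comp ?_
    have h1 : Continuous fun y : SpaceTime d × ℝ => (y.1.1 : EuclideanSpace ℝ (Fin d)) :=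
      (continuous_fst' d).comp continuous_fst
    have h2 : Continuous fun y : SpaceTime d × ℝ => (y.1.2 : ℝ) :=
      (continuous_snd' d).comp continuous_fst
    refine Continuous.prodMk ?_ h2
    refine T.symm.continuous.comp ((PiLp.continuous_toLp 2 _).comp ?_)
    refine continuous_pi fun i => ?_
    refine Fin.lastCases ?_ (fun j => ?_) i
    · simp only [Fin.snoc_last]
      exact continuous_snd
    · simp only [Fin.snoc_castSucc]
      fun_prop

section Chart

variable {d : ℕ} (T : EuclideanSpace ℝ (Fin (d + 1)) ≃ₗᵢ[ℝ] EuclideanSpace ℝ (Fin (d + 1)))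

theorem norm_sq_eq_init_add_last (X : EuclideanSpace ℝ (Fin (d + 1))) :
    ‖X‖ ^ 2 = ‖(WithLp.toLp 2 fun i : Fin d => X i.castSucc : EuclideanSpace ℝ (Fin d))‖ ^ 2 +
      |X (Fin.last d)| ^ 2 := by
  rw [EuclideanSpace.norm_sq_eq, EuclideanSpace.norm_sq_eq, Fin.sum_univ_castSucc]
  simp

theorem norm_init_le (X : EuclideanSpace ℝ (Fin (d + 1))) :
    ‖(WithLp.toLp 2 fun i : Fin d => X i.castSucc : EuclideanSpace ℝ (Fin d))‖ ≤ ‖X‖ := by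
  have h := norm_sq_eq_init_add_last X
  exact abs_le_of_sq_le_sq' (by nlinarith [sq_nonneg |X (Fin.last d)|]) (norm_nonneg _) |>.2

theorem norm_le_init_add_last (X : EuclideanSpace ℝ (Fin (d + 1))) :
    ‖X‖ ≤ ‖(WithLp.toLp 2 fun i : Fin d => X i.castSucc : EuclideanSpace ℝ (Fin d))‖ +
      |X (Fin.last d)| := by
  have h := norm_sq_eq_init_add_last X
  refine abs_le_of_sq_le_sq' ?_ (by positivity) |>.2
  nlinarith [mul_nonneg (norm_nonneg (WithLp.toLp 2 fun i : Fin d => X i.castSucc :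
    EuclideanSpace ℝ (Fin d))) (abs_nonneg (X (Fin.last d)))]

theorem dist_chart_fst_le (p q : SpaceTime (d + 1)) :
    dist (chart T q).1 (chart T p).1 ≤ dist q p := by
  rw [dist_def, dist_def]
  have h := norm_init_le (T (q.1 - p.1))
  rw [T.norm_map, map_sub] at h
  exact add_le_add h le_rfl

theorem abs_chart_snd_sub_le (p q : SpaceTime (d + 1)) :
    |(chart T q).2 - (chart T p).2| ≤ dist q p := by
  rw [dist_def]
  have h := abs_le_norm (T (q.1 - p.1)) (Fin.last d)
  rw [T.norm_map, map_sub] at h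
  have := Real.sqrt_nonneg |q.2 - p.2|
  refine le_trans h ?_
  linarith

theorem dist_le_chart (p q : SpaceTime (d + 1)) :
    dist q p ≤ dist (chart T q).1 (chart T p).1 + |(chart T q).2 - (chart T p).2| := by
  rw [dist_def, dist_def]
  have h := norm_le_init_add_last (T (q.1 - p.1))
  rw [T.norm_map, map_sub] at h
  have h' : ‖q.1 - p.1‖ ≤ ‖(chart T q).1.1 - (chart T p).1.1‖ + |(chart T q).2 - (chart T p).2| := h
  have h'' : (chart T q).1.2 = q.2 := rfl
  have h''' : (chart T p).1.2 = p.2 := rfl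
  rw [h'', h''']
  linarith

theorem mem_cube_of_dist_lt {n : ℕ} {p q : SpaceTime n} {r : ℝ} (h : dist q p < r) :
    q ∈ cube p r := by
  rw [dist_def] at h
  have h1 := norm_nonneg (q.1 - p.1)
  have h2 := Real.sqrt_nonneg |q.2 - p.2|
  refine ⟨fun i => ?_, (Real.sqrt_lt' (by linarith)).mp (by linarith)⟩
  have h3 := abs_le_norm (q.1 - p.1) i
  rw [PiLp.sub_apply] at h3
  linarith

theorem chart_symm_mem_cube {q : SpaceTime (d + 1)} {y : SpaceTime d × ℝ} {r : ℝ}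
    (h : dist y.1 (chart T q).1 + |y.2 - (chart T q).2| < r) : (chart T).symm y ∈ cube q r := by
  refine mem_cube_of_dist_lt ((dist_le_chart T q _).trans_lt ?_)
  rwa [Homeomorph.apply_symm_apply]

/-- Cubes are convex along vertical segments. -/
theorem chart_symm_mem_cube_of_mem_Icc {s : SpaceTime (d + 1)} {z : SpaceTime d} {a b h r : ℝ}
    (ha : (chart T).symm (z, a) ∈ cube s r) (hb : (chart T).symm (z, b) ∈ cube s r)
    (hh : h ∈ Icc a b) : (chart T).symm (z, h) ∈ cube s r := by
  refine ⟨fun i => ?_, ha.2⟩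
  obtain ⟨θ, η, hθ, hη, hθη, rfl⟩ : h ∈ segment ℝ a b := by
    rw [segment_eq_Icc (hh.1.trans hh.2)]; exact hh
  have hlin : ((chart T).symm (z, θ • a + η • b)).1 =
      θ • ((chart T).symm (z, a)).1 + η • ((chart T).symm (z, b)).1 := by
    change T.symm _ = θ • T.symm _ + η • T.symm _
    rw [← map_smul, ← map_smul, ← map_add]
    congr 1
    ext j
    refine Fin.lastCases ?_ (fun k => ?_) j
    · simp
    · simp only [PiLp.add_apply, PiLp.smul_apply, Fin.snoc_castSucc, smul_eq_mul]
      rw [← add_mul, hθη, one_mul]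
  have h1 := ha.1 i
  have h2 := hb.1 i
  rw [hlin, PiLp.add_apply, PiLp.smul_apply, PiLp.smul_apply, smul_eq_mul, smul_eq_mul]
  have hconv := convex_ball (s.1 i) r
  have h3 := hconv (x := ((chart T).symm (z, a)).1 i) (y := ((chart T).symm (z, b)).1 i)
    (by rw [Metric.mem_ball, Real.dist_eq]; exact h1)
    (by rw [Metric.mem_ball, Real.dist_eq]; exact h2) hθ hη hθη
  rw [Metric.mem_ball, Real.dist_eq] at h3
  exact h3

end Chart

open Module in
/-- Some rotation makes a given vector vertical. -/
theorem exists_rotation_vertical {d : ℕ} (v : EuclideanSpace ℝ (Fin (d + 1))) :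
    ∃ T : EuclideanSpace ℝ (Fin (d + 1)) ≃ₗᵢ[ℝ] EuclideanSpace ℝ (Fin (d + 1)),
      LinearMap.det (T.toLinearEquiv : EuclideanSpace ℝ (Fin (d + 1)) →ₗ[ℝ]
        EuclideanSpace ℝ (Fin (d + 1))) = 1 ∧ ∀ i : Fin d, T v i.castSucc = 0 := by
  set e : EuclideanSpace ℝ (Fin (d + 1)) := EuclideanSpace.single (Fin.last d) 1 with he
  have he1 : ‖e‖ = 1 := by simp [he]
  have he0 : e ≠ 0 := fun h => by rw [h, norm_zero] at he1; exact zero_ne_one he1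
  have hei : ∀ (a : ℝ) (i : Fin d), (a • e) i.castSucc = 0 := fun a i => by
    simp [he, Fin.castSucc_ne_last]
  set w := ‖v‖ • e with hw
  have hvw : ‖v‖ = ‖w‖ := by rw [hw, norm_smul, he1, mul_one, norm_norm]
  set T₀ := ((ℝ ∙ (v - w))ᗮ).reflection with hT₀
  have hT₀v : T₀ v = w := Submodule.reflection_sub hvw
  have hdet₀ : LinearMap.det (T₀.toLinearEquiv : EuclideanSpace ℝ (Fin (d + 1)) →ₗ[ℝ]
      EuclideanSpace ℝ (Fin (d + 1))) = (-1) ^ finrank ℝ (ℝ ∙ (v - w))ᗮᗮ :=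
    Submodule.det_reflection _
  -- The reflection may be trivial (when `v = w`), so only the sign of its determinant is examined.
  -- If it is negative, a reflection along the vertical axis restores orientation.
  rcases neg_one_pow_eq_or ℝ (finrank ℝ (ℝ ∙ (v - w))ᗮᗮ) with h | h
  · exact ⟨T₀, hdet₀.trans h, fun i => by rw [hT₀v]; exact hei _ i⟩
  · set T₁ := ((ℝ ∙ e)ᗮ).reflection with hT₁
    have hT₁e : T₁ e = -e := Submodule.reflection_orthogonalComplement_singleton_eq_neg e
    have hdet₁ : LinearMap.det (T₁.toLinearEquiv : EuclideanSpace ℝ (Fin (d + 1)) →ₗ[ℝ]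
        EuclideanSpace ℝ (Fin (d + 1))) = (-1) ^ finrank ℝ (ℝ ∙ e)ᗮᗮ :=
      Submodule.det_reflection _
    rw [Submodule.orthogonal_orthogonal, finrank_span_singleton he0, pow_one] at hdet₁
    refine ⟨T₀.trans T₁, ?_, fun i => ?_⟩
    · have hcomp : ((T₀.trans T₁).toLinearEquiv : EuclideanSpace ℝ (Fin (d + 1)) →ₗ[ℝ]
          EuclideanSpace ℝ (Fin (d + 1))) = T₁.toLinearEquiv.toLinearMap ∘ₗ
          T₀.toLinearEquiv.toLinearMap := rfl
      rw [hcomp, LinearMap.det_comp, hdet₁, hdet₀, h]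
      norm_num
    · rw [LinearIsometryEquiv.trans_apply, hT₀v, hw, map_smul, hT₁e, smul_neg, ← neg_smul]
      exact hei _ i

end SpaceTime

/-! ### From components of the complement to crossing regions -/

/-- Components of the open complement are open. A frontier point off `S` would have a component of
its own meeting the given one, hence equal to it, and an open set contains no point of its frontier.
-/
theorem frontier_connectedComponentIn_subset {Y : Type*} [TopologicalSpace Y]
    [LocallyConnectedSpace Y] {S : Set Y} (hS : IsClosed S) (a : Y) :
    frontier (connectedComponentIn Sᶜ a) ⊆ S := by
  intro y hy
  by_contra hyS
  have hU : IsOpen (connectedComponentIn Sᶜ a) := hS.isOpen_compl.connectedComponentIn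
  have hV : IsOpen (connectedComponentIn Sᶜ y) := hS.isOpen_compl.connectedComponentIn
  rw [hU.frontier_eq] at hy
  obtain ⟨x, hxV, hxU⟩ := mem_closure_iff.mp hy.1 _ hV (mem_connectedComponentIn hyS)
  refine hy.2 ?_
  rw [connectedComponentIn_eq hxU, ← connectedComponentIn_eq hxV]
  exact mem_connectedComponentIn hyS

theorem disjoint_connectedComponentIn {Y : Type*} [TopologicalSpace Y] {F : Set Y} {a b : Y}
    (h : connectedComponentIn F a ≠ connectedComponentIn F b) :
    Disjoint (connectedComponentIn F a) (connectedComponentIn F b) :=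
  disjoint_left.mpr fun _ ha hb =>
    h ((connectedComponentIn_eq ha).trans (connectedComponentIn_eq hb).symm)

namespace SpaceTime

theorem cube_subset_cube {n : ℕ} {p q : SpaceTime n} {r s u : ℝ} (hq : q ∈ cube p s)
    (hr : 0 ≤ r) (hs : 0 ≤ s) (hu : r + s ≤ u) : cube q r ⊆ cube p u := by
  intro x hx
  refine ⟨fun i => ?_, ?_⟩
  · have h1 := abs_sub_le (x.1 i) (q.1 i) (p.1 i)
    linarith [hx.1 i, hq.1 i]
  · have h1 := abs_sub_le x.2 q.2 p.2
    have h2 : r ^ 2 + s ^ 2 ≤ u ^ 2 := by nlinarith [mul_nonneg hr hs]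
    linarith [hx.2, hq.2]

theorem cube_mono {n : ℕ} (p : SpaceTime n) {r s : ℝ} (hr : 0 ≤ r) (h : r ≤ s) :
    cube p r ⊆ cube p s :=
  fun _ hx => ⟨fun i => (hx.1 i).trans_le h, hx.2.trans_le (by gcongr)⟩

theorem cube_subset_timeStrip {n : ℕ} {S : Set (SpaceTime n)} {s : SpaceTime n} {r δ : ℝ}
    (hr : 0 ≤ r) (h : r ≤ δ)
    (h₀ : initialTime S < ((s.2 - δ ^ 2 : ℝ) : EReal))
    (h₁ : ((s.2 + δ ^ 2 : ℝ) : EReal) < finalTime S) : cube s r ⊆ timeStrip S := by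
  intro q hq
  have h2 : r ^ 2 ≤ δ ^ 2 := by gcongr
  obtain ⟨h3, h4⟩ := abs_lt.mp hq.2
  exact ⟨h₀.trans_le (EReal.coe_le_coe_iff.mpr (by linarith)),
    lt_of_le_of_lt (EReal.coe_le_coe_iff.mpr (by linarith)) h₁⟩

/-- Away from the initial and final times, every surface cube contains a cube of comparable size
missing a given component of the complement. -/
theorem exists_cube_disjoint_component {n : ℕ} {S : Set (SpaceTime n)} {γ : ℝ} (hγ : 0 < γ)
    (h2 : WeakTimeSyncTwoCube S γ) {w : SpaceTime n} {r : ℝ} (hw : Admissible S w r)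
    (hstrip : cube w r ⊆ timeStrip S) (a : SpaceTime n) :
    ∃ (q : SpaceTime n), cube q (γ * r) ⊆ cube w r ∧
      Disjoint (cube q (γ * r)) (connectedComponentIn Sᶜ a) := by
  obtain ⟨ρ, q₁, q₂, hγρ, -, -, h₁, h₂, b₁, -, b₂, -, hne, hc₁, hc₂⟩ := h2 w r hw
  have hγr : 0 < γ * r := mul_pos hγ hw.2.2.1
  -- Inside the strip the two cubes lie entirely in their components, and the given component is
  -- different from at least one of these.
  rw [inter_eq_left.mpr (h₁.trans hstrip)] at hc₁
  rw [inter_eq_left.mpr (h₂.trans hstrip)] at hc₂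
  by_cases h : connectedComponentIn Sᶜ a = connectedComponentIn Sᶜ b₁
  · refine ⟨q₂, (cube_mono _ hγr.le hγρ).trans h₂, ?_⟩
    rw [h]
    exact (disjoint_connectedComponentIn hne.symm).mono_left ((cube_mono _ hγr.le hγρ).trans hc₂)
  · exact ⟨q₁, (cube_mono _ hγr.le hγρ).trans h₁,
      (disjoint_connectedComponentIn (Ne.symm h)).mono_left ((cube_mono _ hγr.le hγρ).trans hc₁)⟩

/-- Two vertically aligned cubes on different sides of a regular surface span a crossing region. -/
theorem isCrossingRegion_of_cubes {d : ℕ} {S : Set (SpaceTime (d + 1))} {M γ c : ℝ}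
    (hγ : 0 < γ) (hc : 0 < c)
    (hν : ∀ (x : SpaceTime d) (r : ℝ), 0 < r →
      lebesgue d (Metric.ball x r) ≤ ENNReal.ofReal (c * r ^ (d + 2)))
    (hS : IsClosed S) (hADR : IsParabolicADR S M) (h2 : WeakTimeSyncTwoCube S γ)
    {p s p₁ p₂ : SpaceTime (d + 1)} {R r ρ : ℝ} (hp : Admissible S p R) (hρ : 0 < ρ) (hρr : ρ < r)
    (hrR : r ≤ R) (hstrip : cube s (2 * r) ⊆ timeStrip S) (hsub : cube s (2 * r) ⊆ cube p R)
    (hp₁ : cube p₁ ρ ⊆ cube s r) (hp₂ : cube p₂ ρ ⊆ cube s r) {a : SpaceTime (d + 1)}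
    (ha₁ : cube p₁ ρ ⊆ connectedComponentIn Sᶜ a)
    (ha₂ : Disjoint (cube p₂ ρ) (connectedComponentIn Sᶜ a))
    (T : EuclideanSpace ℝ (Fin (d + 1)) ≃ₗᵢ[ℝ] EuclideanSpace ℝ (Fin (d + 1)))
    (hbase : (chart T p₁).1 = (chart T p₂).1) (hlt : (chart T p₁).2 < (chart T p₂).2) :
    (∀ y : SpaceTime d × ℝ, y.1 ∈ Metric.ball (chart T p₁).1 (ρ / 2) →
      y.2 ∈ Icc (chart T p₁).2 (chart T p₂).2 → (chart T).symm y ∈ cube s r) ∧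
    IsCrossingRegion (lebesgue d)
      (((parHausdorff (d + 1) ((d + 1 : ℕ) + 1 : ℝ)).restrict (S ∩ cube p R)).map (chart T))
      ((chart T).symm ⁻¹' connectedComponentIn Sᶜ a) ((chart T).symm ⁻¹' S) (chart T p₁).1 (ρ / 2)
      (chart T p₁).2 (chart T p₂).2 (d + 2) (c * 2 ^ (d + 2)) (M⁻¹ / (d + 3) ^ (d + 2))
      (γ / (2 * (d + 3))) := by
  have hr : 0 < r := hρ.trans hρr
  -- The region has base radius `ρ / 2`, so that base distance and height difference together stay
  -- below `ρ`.
  have hlow : ∀ y : SpaceTime d × ℝ, y.1 ∈ Metric.ball (chart T p₁).1 (ρ / 2) →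
      y.2 ∈ Icc (chart T p₁).2 ((chart T p₁).2 + ρ / 2) → (chart T).symm y ∈ cube p₁ ρ := by
    intro y hy1 hy2
    refine chart_symm_mem_cube T ?_
    have h3 : |y.2 - (chart T p₁).2| ≤ ρ / 2 := by
      rw [abs_le]; constructor <;> linarith [hy2.1, hy2.2]
    linarith [Metric.mem_ball.mp hy1]
  have hupp : ∀ z ∈ Metric.ball (chart T p₁).1 (ρ / 2),
      (chart T).symm (z, (chart T p₂).2) ∈ cube p₂ ρ := by
    intro z hz
    refine chart_symm_mem_cube T ?_
    rw [sub_self, abs_zero, add_zero, ← hbase]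
    linarith [Metric.mem_ball.mp hz]
  have hwin : ∀ y : SpaceTime d × ℝ, y.1 ∈ Metric.ball (chart T p₁).1 (ρ / 2) →
      y.2 ∈ Icc (chart T p₁).2 (chart T p₂).2 → (chart T).symm y ∈ cube s r := by
    rintro ⟨z, h⟩ hz hh
    refine chart_symm_mem_cube_of_mem_Icc T (hp₁ (hlow (z, (chart T p₁).2) hz ⟨le_rfl, ?_⟩))
      (hp₂ (hupp z hz)) hh
    linarith
  have hμ : ∀ A : Set (SpaceTime d × ℝ),
      ((parHausdorff (d + 1) ((d + 1 : ℕ) + 1 : ℝ)).restrict (S ∩ cube p R)).map (chart T) A =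
      parHausdorff (d + 1) ((d + 1 : ℕ) + 1 : ℝ) (chart T ⁻¹' A ∩ (S ∩ cube p R)) := by
    intro A
    have h3 := (chart T).toMeasurableEquiv.map_apply
      (μ := (parHausdorff (d + 1) ((d + 1 : ℕ) + 1 : ℝ)).restrict (S ∩ cube p R)) A
    refine h3.trans (Measure.restrict_apply' ?_)
    have hcube : IsOpen (cube p R) := by
      have h4 := continuous_fst' (d + 1)
      have h5 := continuous_snd' (d + 1)
      have h6 : IsOpen {q : SpaceTime (d + 1) | |q.2 - p.2| < R ^ 2} :=
        isOpen_lt (by fun_prop) continuous_const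
      refine IsOpen.inter ?_ h6
      change IsOpen {q : SpaceTime (d + 1) | ∀ i, |q.1 i - p.1 i| < R}
      simp only [ofPred_forall]
      exact isOpen_iInter_of_finite fun i => isOpen_lt (by fun_prop) continuous_const
    exact hS.measurableSet.inter hcube.measurableSet
  -- facts about small cubes centred on the surface
  have hd : (0 : ℝ) < d + 3 := by positivity
  have hsmall : ∀ y : SpaceTime d × ℝ, (chart T).symm y ∈ S →
      y.1 ∈ Metric.ball (chart T p₁).1 (ρ / 2) → y.2 ∈ Icc (chart T p₁).2 (chart T p₂).2 →
      ∀ t, 0 < t → t ≤ ρ / 2 → Admissible S ((chart T).symm y) (t / (d + 3)) ∧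
        cube ((chart T).symm y) (t / (d + 3)) ⊆ cube s (2 * r) ∧
        ∀ q ∈ cube ((chart T).symm y) (t / (d + 3)),
          (chart T q).1 ∈ Metric.ball y.1 t ∧ (chart T q).2 ∈ Ioo (y.2 - t) (y.2 + t) := by
    intro y hyS hy1 hy2 t ht htρ
    have hw := hwin y hy1 hy2
    have ht' : 0 < t / (d + 3) := by positivity
    have htt : t / (d + 3) ≤ t := div_le_self ht.le (by linarith [Nat.cast_nonneg (α := ℝ) d])
    refine ⟨hp.of_le hyS (hstrip (cube_mono s hr.le (by linarith) hw)) ht' (by linarith),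
      cube_subset_cube hw ht'.le hr.le (by linarith), fun q hq => ?_⟩
    -- Points of a cube of length `t / (d + 3)` in spatial dimension `d + 1` are within `(d + 2) t /
    -- (d + 3) < t` of the centre. This is the source of the factor `d + 3` in the constants.
    have h3 : dist q ((chart T).symm y) < t := by
      refine (dist_le_of_mem_cube ht' hq).trans_lt ?_
      push_cast
      rw [← mul_div_assoc, div_lt_iff₀ hd]
      nlinarith
    have h4 := dist_chart_fst_le T ((chart T).symm y) q
    have h5 := abs_chart_snd_sub_le T ((chart T).symm y) q
    rw [Homeomorph.apply_symm_apply] at h4 h5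
    refine ⟨Metric.mem_ball.mpr (by linarith), ?_⟩
    have h6 := abs_lt.mp (h5.trans_lt h3)
    exact ⟨by linarith, by linarith⟩
  refine ⟨hwin, ?_⟩
  constructor
  · positivity
  · exact (hS.isOpen_compl.connectedComponentIn).preimage (chart T).symm.continuous
  · exact hS.preimage (chart T).symm.continuous
  · rw [← Homeomorph.preimage_frontier]
    exact preimage_mono (frontier_connectedComponentIn_subset hS a)
  · exact hlt
  · exact fun z hz h hh => ha₁ (hlow (z, h) hz hh)
  · exact fun z hz hU => disjoint_left.mp ha₂ (hupp z hz) hU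
  · intro A hA
    rw [hμ]
    have hf : LipschitzWith 1 fun q : SpaceTime (d + 1) => (chart T q).1 :=
      LipschitzWith.of_dist_le_mul fun q q' => by
        rw [NNReal.coe_one, one_mul]; exact dist_chart_fst_le T q' q
    have h3 := measure_image_le_parHausdorff hc hν hf (chart T ⁻¹' A)
    have h4 : (((d + 2 : ℕ) : ℝ)) = ((d + 1 : ℕ) + 1 : ℝ) := by push_cast; ring
    rw [h4] at h3
    have h5 : (fun q : SpaceTime (d + 1) => (chart T q).1) '' (chart T ⁻¹' A) = Prod.fst '' A := by
      rw [← (chart T).image_preimage A, image_image, (chart T).image_preimage]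
    rw [h5] at h3
    refine h3.trans (le_of_eq ?_)
    congr 2
    refine (inter_eq_left.mpr fun q hq => ?_).symm
    have h6 := hA hq
    have h7 : (chart T).symm (chart T q) = q := (chart T).symm_apply_apply q
    refine ⟨by simpa only [mem_preimage, h7] using h6.1, ?_⟩
    have h8 := hwin _ h6.2.1 h6.2.2
    rw [h7] at h8
    exact hsub (cube_mono s hr.le (by linarith) h8)
  · intro y hyS hy1 hy2 t ht htρ
    obtain ⟨hadm, hcube, hbox⟩ := hsmall y hyS hy1 hy2 t ht htρ
    rw [hμ]
    have h3 := (hADR _ _ hadm).1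
    rw [surfaceMeasure_surfaceCube hS] at h3
    have h4 : M⁻¹ / (d + 3) ^ (d + 2) * t ^ (d + 2) = M⁻¹ * (t / (d + 3)) ^ (d + 1 + 1) := by
      rw [div_pow]; ring
    rw [h4]
    refine h3.trans (measure_mono ?_)
    rintro q ⟨hqS, hq⟩
    exact ⟨hbox q hq, hqS, hsub (hcube hq)⟩
  · intro y hyS hy1 hy2 t ht htρ
    obtain ⟨hadm, hcube, hbox⟩ := hsmall y hyS hy1 hy2 t ht htρ
    obtain ⟨q, hq, hqU⟩ := exists_cube_disjoint_component hγ h2 hadm (hcube.trans hstrip) a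
    have hγt : 0 < γ * (t / (d + 3)) := by positivity
    obtain ⟨h3, h4⟩ := hbox q (hq (mem_cube_self q hγt))
    refine ⟨chart T q, h3, h4, ?_⟩
    refine disjoint_left.mpr fun x hx hxU => disjoint_left.mp hqU ?_ hxU
    refine chart_symm_mem_cube T ?_
    have h5 := Metric.mem_ball.mp hx.1
    have h6 : |x.2 - (chart T q).2| < γ / (2 * (d + 3)) * t := by
      rw [abs_lt]; constructor <;> linarith [hx.2.1, hx.2.2]
    -- Half of the cube's length is spent on the base distance and half on the height, hence the 2
    -- in `γ / (2 * (d + 3))`.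
    have h7 : γ * (t / (d + 3)) = γ / (2 * (d + 3)) * t + γ / (2 * (d + 3)) * t := by
      field_simp; ring
    rw [h7]
    exact add_lt_add h5 h6

/-- A Lipschitz function on a subset of the base whose graph lies on the surface yields a big piece
of a Lip(1,1/2) graph. -/
theorem exists_isLipHalf_of_lipschitzOnWith {d : ℕ} {A : Set (SpaceTime (d + 1))}
    (T : EuclideanSpace ℝ (Fin (d + 1)) ≃ₗᵢ[ℝ] EuclideanSpace ℝ (Fin (d + 1)))
    {F : Set (SpaceTime d)} {g : SpaceTime d → ℝ} {b : NNReal} (hg : LipschitzOnWith b g F)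
    (hF : ∀ z ∈ F, (chart T).symm (z, g z) ∈ A) :
    ∃ ψ : EuclideanSpace ℝ (Fin d) × ℝ → ℝ, IsLipHalf b ψ ∧
      lebesgue d F ≤ volume (proj '' (graph ψ ∩ spaceMap T '' A)) := by
  -- Lip(1,1/2) is exactly Lipschitz for the parabolic distance on the base, so the extension keeps
  -- the constant.
  obtain ⟨f, hf, hfg⟩ := hg.extend_real
  refine ⟨fun z => f (homeo d z), fun x y t s => ?_, ?_⟩
  · have h1 := hf.dist_le_mul (homeo d (x, t)) (homeo d (y, s))
    rw [Real.dist_eq] at h1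
    exact h1
  · rw [lebesgue_apply]
    refine measure_mono fun z hz => ?_
    have hz' : homeo d z ∈ F := hz
    have h1 : chart T ((chart T).symm (homeo d z, g (homeo d z))) = (homeo d z, g (homeo d z)) :=
      (chart T).apply_symm_apply _
    refine ⟨spaceMap T ((chart T).symm (homeo d z, g (homeo d z))), ⟨?_, _, hF _ hz', rfl⟩, ?_⟩
    · have h2 := congrArg Prod.snd h1
      have h3 := congrArg (fun y => f y.1) h1
      exact h2.trans ((hfg hz').trans h3.symm)
    · exact congrArg Prod.fst h1

end SpaceTime

/-! ### Proof of the theorem -/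

open SpaceTime in
theorem mainTheorem1 (d : ℕ) (M γ₁ : ℝ) (hM : 1 ≤ M) (hγ₀ : 0 < γ₁) (hγ₁ : γ₁ < 1) :
    ∃ ε b : ℝ, 0 < ε ∧ 0 ≤ b ∧
      ∀ S : Set (SpaceTime (d + 1)), IsClosed S →
        SpaceTime.IsParabolicADR S M →
        SpaceTime.WeakTimeSyncTwoCube S γ₁ →
        SpaceTime.HasBigPiecesLipHalfGraphs S ε b := by
  obtain ⟨c₁, c₂, hc₁, hc₂, hν₁, hν₂⟩ := exists_lebesgue_ball_bounds d
  obtain ⟨N, hN2, hN⟩ := exists_interior_time (d + 1) hM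
  have hN2' : (2 : ℝ) ≤ N := by exact_mod_cast hN2
  have hM0 : 0 < M := by linarith
  have hd : (0 : ℝ) ≤ d := Nat.cast_nonneg d
  -- The base radius is `ρ / 2` with `ρ ≥ γ₁ r` and `R = 8 N r`, so `R ≤ (16 N / γ₁) (ρ / 2)`; this
  -- turns the mass bound `M R ^ (d + 2)` into `c₄`. The centres of the cubes are within `2 (d + 2)
  -- r` of each other, which gives `A`.
  obtain ⟨ε, b, hε, hcore⟩ := exists_lipschitzOnWith_firstExit (lebesgue d) (d + 2)
    (c₀ := c₂ * 2 ^ (d + 2)) (c₁ := c₁) (c₂ := c₂) (c₃ := M⁻¹ / (d + 3) ^ (d + 2))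
    (c₄ := M * (16 * N / γ₁) ^ (d + 2)) (γ := γ₁ / (2 * (d + 3))) (A := 4 * (d + 2) / γ₁)
    (by positivity) hc₁ hc₂ (by positivity) (by positivity) (by positivity)
    (by rw [div_le_one (by positivity)]; linarith) (by positivity) isPreconnected_ball hν₁ hν₂
  refine ⟨ε * (γ₁ / (16 * N)) ^ (d + 2), b, by positivity, b.2, fun S hS hADR h2 p R hp => ?_⟩
  have hR := hp.2.2.1
  obtain ⟨s, hsS, hsp, hs₀, hs₁⟩ := hN S hS hADR p R hp
  -- Small enough that the cube of length `2 r` about `s` stays in the time strip and in the cube of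
  -- length `R` about `p`.
  set r := R / (8 * N) with hr
  have hr0 : 0 < r := by positivity
  have hRr : R = 8 * N * r := by rw [hr]; field_simp
  have hstrip : cube s (2 * r) ⊆ timeStrip S := by
    refine cube_subset_timeStrip (by positivity) ?_ hs₀ hs₁
    rw [le_div_iff₀ (by positivity), hRr]
    nlinarith
  have hrR : 4 * r ≤ R := by rw [hRr]; nlinarith
  have hsub : cube s (2 * r) ⊆ cube p R :=
    cube_subset_cube hsp (by positivity) (by positivity) (by linarith)
  have hadm : Admissible S s r :=
    hp.of_le hsS (hstrip (mem_cube_self s (by positivity))) hr0 (by linarith)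
  obtain ⟨ρ, p₁, p₂, hγρ, hρr, htime, hp₁, hp₂, a₁, -, a₂, -, hne, ha₁, ha₂⟩ := h2 s r hadm
  have hρ : 0 < ρ := lt_of_lt_of_le (by positivity) hγρ
  have hstrip' : cube s r ⊆ timeStrip S := (cube_mono s hr0.le (by linarith)).trans hstrip
  rw [inter_eq_left.mpr (hp₁.trans hstrip')] at ha₁
  rw [inter_eq_left.mpr (hp₂.trans hstrip')] at ha₂
  have hdisj := disjoint_connectedComponentIn hne
  obtain ⟨T, hT, hTv⟩ := exists_rotation_vertical (p₁.1 - p₂.1)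
  -- Synchronized times are used here: a rotation of space can align the centres vertically only if
  -- their times agree.
  have hbase : (chart T p₁).1 = (chart T p₂).1 := by
    refine Prod.ext ?_ htime
    ext i
    have h3 := hTv i
    rw [map_sub, PiLp.sub_apply, sub_eq_zero] at h3
    exact h3
  have key : ∀ (q₁ q₂ a : SpaceTime (d + 1)), cube q₁ ρ ⊆ cube s r → cube q₂ ρ ⊆ cube s r →
      cube q₁ ρ ⊆ connectedComponentIn Sᶜ a → Disjoint (cube q₂ ρ) (connectedComponentIn Sᶜ a) →
      (chart T q₁).1 = (chart T q₂).1 → (chart T q₁).2 < (chart T q₂).2 →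
      ∃ ψ : EuclideanSpace ℝ (Fin d) × ℝ → ℝ, IsLipHalf b ψ ∧
        ENNReal.ofReal (ε * (γ₁ / (16 * N)) ^ (d + 2) * R ^ (d + 2)) ≤
          volume (proj '' (graph ψ ∩ spaceMap T '' surfaceCube S p R)) := by
    intro q₁ q₂ a hq₁ hq₂ hqa₁ hqa₂ hqb hqlt
    obtain ⟨hwin, H⟩ := isCrossingRegion_of_cubes hγ₀ hc₂ hν₂ hS hADR h2 hp hρ hρr
      (by linarith) hstrip hsub hq₁ hq₂ hqa₁ hqa₂ T hqb hqlt
    have hrρ : r ≤ ρ / γ₁ := by rw [le_div_iff₀ hγ₀]; linarith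
    obtain ⟨F, hFsub, hFlip, hFν⟩ := hcore _ _ _ _ _ _ _ H
      (by
        have h3 := abs_chart_snd_sub_le T q₁ q₂
        have h4 := dist_le_of_mem_cube hr0 (hq₁ (mem_cube_self q₁ hρ))
        have h5 := dist_le_of_mem_cube hr0 (hq₂ (mem_cube_self q₂ hρ))
        have h6 := dist_triangle_right q₂ q₁ s
        push_cast at h4 h5
        have h7 : 4 * (d + 2) / γ₁ * (ρ / 2) = 2 * (d + 2) * (ρ / γ₁) := by ring
        have h8 : 2 * ((d : ℝ) + 2) * r ≤ 2 * (d + 2) * (ρ / γ₁) := by gcongr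
        have h9 := le_abs_self ((chart T q₂).2 - (chart T q₁).2)
        linarith)
      (by
        rw [Measure.map_apply (chart T).continuous.measurable MeasurableSet.univ, preimage_univ,
          Measure.restrict_apply_univ]
        have h3 := (hADR p R hp).2
        rw [surfaceMeasure_surfaceCube hS] at h3
        refine h3.trans (ENNReal.ofReal_le_ofReal ?_)
        rw [mul_assoc, ← mul_pow]
        have h4 : R ≤ 16 * N / γ₁ * (ρ / 2) := by
          calc R = 8 * N * r := hRr
            _ ≤ 8 * N * (ρ / γ₁) := by gcongr
            _ = _ := by ring
        gcongr)
    have hmem : ∀ z ∈ F, (chart T).symm (z, firstExit ((chart T).symm ⁻¹'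
        connectedComponentIn Sᶜ a) (chart T q₁).2 (chart T q₂).2 z) ∈ surfaceCube S p R := by
      intro z hz
      refine ⟨H.firstExit_mem_surface (hFsub hz), hsub (cube_mono s hr0.le (by linarith)
        (hwin _ (hFsub hz) ⟨?_, H.firstExit_le⟩))⟩
      have h3 := H.add_lt_firstExit (hFsub hz)
      simp only
      linarith
    obtain ⟨ψ, hψ, hψν⟩ := exists_isLipHalf_of_lipschitzOnWith T hFlip hmem
    refine ⟨ψ, hψ, le_trans (ENNReal.ofReal_le_ofReal ?_) (hFν.trans hψν)⟩
    rw [mul_assoc, ← mul_pow]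
    have h3 : γ₁ / (16 * N) * R ≤ ρ / 2 := by
      have h4 : γ₁ / (16 * N) * R = γ₁ * r / 2 := by rw [hRr]; field_simp; ring
      linarith
    gcongr
  have hmem₁ := ha₁ (mem_cube_self p₁ hρ)
  have hmem₂ := ha₂ (mem_cube_self p₂ hρ)
  -- Either cube may be the lower one; equal heights would make the centres coincide, against the
  -- components being disjoint.
  rcases lt_trichotomy (chart T p₁).2 (chart T p₂).2 with h | h | h
  · obtain ⟨ψ, hψ⟩ := key p₁ p₂ a₁ hp₁ hp₂ ha₁ (hdisj.symm.mono_left ha₂) hbase h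
    exact ⟨T, ψ, hT, hψ⟩
  · have h3 : p₁ = p₂ := (chart T).injective (Prod.ext hbase h)
    rw [h3] at hmem₁
    exact absurd hmem₂ (disjoint_left.mp hdisj hmem₁)
  · obtain ⟨ψ, hψ⟩ := key p₂ p₁ a₂ hp₂ hp₁ ha₂ (hdisj.mono_left ha₁) hbase.symm h
    exact ⟨T, ψ, hT, hψ⟩
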